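/- Let $D\ge 1$ and $k\ge 0$ be integers and let $\mathbb{P}^k_D$ be the space of real polynomials in $D$ variables of total degree at most $k$. A polytope $K\subset\mathbb{R}^D$ is a nonempty compact set, not necessarily convex, that is the closure of its interior and a finite union of intersections of finitely many closed half-spaces. It is called star-regular if there are a center $c\in\mathbb{R}^D$ and a constant $\rho>0$ such that $K$ is star-convex about $c$ and $\mathbf{\hat n}\cdot(\mathbf{x}-c)=\rho$ for every boundary point $\mathbf{x}$ of $K$ at which the outward unit normal $\mathbf{\hat n}$ exists. For $U\in\mathbb{P}^k_D$ let $\overline{\mathcal{C}}U$ be the average of $U$ over $K$ with respect to Lebesgue measure and let $\overline{\mathcal{B}}U$ be the average of $U$ over $\partial K$ with respect to $(D-1)$-dimensional surface measure. The optimal interior weight of $K$ is $$\overline{M}{}^k_K:=\sup\left\{\frac{\overline{\mathcal{B}}U}{\overline{\mathcal{C}}U} : U\in\mathbb{P}^k_D,\ U\ge 0\text{ on }K,\ \overline{\mathcal{C}}U>0\right\}.$$ Then for every star-regular polytope $K\subset\mathbb{R}^D$ this supremum is finite and $$\overline{M}{}^k_K\le\frac{\left(\lfloor k/2\rfloor+1\right)\left(\lfloor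 (k+1)/2\rfloor+D\right)}{D}.$$ In particular, every regular simplex in $\mathbb{R}^D$ (a nondegenerate $D$-dimensional simplex all of whose edges have the same length) is a star-regular polytope, so the bound holds for it. -/

import Mathlib

open MeasureTheory

noncomputable section

/-- A closed convex polyhedron: the intersection of finitely many closed half-spaces
`{x | ⟪a, x⟫ ≤ b}`. -/
def IsConvexPolyhedron {D : ℕ} (P : Set (EuclideanSpace ℝ (Fin D))) : Prop :=
  ∃ S : Finset (EuclideanSpace ℝ (Fin D) × ℝ), P = {x | ∀ h ∈ S, inner ℝ h.1 x ≤ h.2}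

/-- A full-dimensional, not necessarily convex, polytope in `ℝ^D`: a nonempty compact set that is
the closure of its interior and a finite union of closed convex polyhedra. -/
structure IsSolidPolytope {D : ℕ} (K : Set (EuclideanSpace ℝ (Fin D))) : Prop where
  nonempty : K.Nonempty
  isCompact : IsCompact K
  closure_interior : closure (interior K) = K
  polyhedral : ∃ F : Set (Set (EuclideanSpace ℝ (Fin D))),
    F.Finite ∧ (∀ P ∈ F, IsConvexPolyhedron P) ∧ K = ⋃₀ F

/-- `n` is the outward unit normal of `K` at the boundary point `x`, where `x` lies in the relative
interior of a face of codimension one: near `x`, the set `K` is the half-space with outward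
normal `n`. -/
def IsOutwardUnitNormal {D : ℕ} (K : Set (EuclideanSpace ℝ (Fin D)))
    (x n : EuclideanSpace ℝ (Fin D)) : Prop :=
  x ∈ frontier K ∧ ‖n‖ = 1 ∧
    ∃ ε > 0, ∀ y ∈ Metric.ball x ε, (y ∈ K ↔ inner ℝ n (y - x) ≤ 0)

/-- A star-regular polytope: a polytope which is star-convex about some center `c` and for which
`n · (x - c)` takes a constant positive value, the radius, as `x` ranges over the boundary points
at which there is an outward unit normal `n`. -/
def IsStarRegularPolytope {D : ℕ} (K : Set (EuclideanSpace ℝ (Fin D))) : Prop :=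
  IsSolidPolytope K ∧
    ∃ c : EuclideanSpace ℝ (Fin D), StarConvex ℝ c K ∧
      ∃ ρ : ℝ, 0 < ρ ∧ ∀ x n, IsOutwardUnitNormal K x n → inner ℝ n (x - c) = ρ

/-- The value of the polynomial `U` in `D` variables at the point `x`. -/
def polyValue {D : ℕ} (U : MvPolynomial (Fin D) ℝ) (x : EuclideanSpace ℝ (Fin D)) : ℝ :=
  MvPolynomial.eval (fun i => x i) U

/-- The average of `U` over the cell `K` with respect to Lebesgue measure. -/
def cellAverage {D : ℕ} (K : Set (EuclideanSpace ℝ (Fin D))) (U : MvPolynomial (Fin D) ℝ) : ℝ :=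
  ⨍ x in K, polyValue U x

/-- The average of `U` over the boundary of `K` with respect to surface measure, that is, the
`(D - 1)`-dimensional Hausdorff measure. -/
def boundaryAverage {D : ℕ} (K : Set (EuclideanSpace ℝ (Fin D)))
    (U : MvPolynomial (Fin D) ℝ) : ℝ :=
  ⨍ x in frontier K, polyValue U x ∂(Measure.hausdorffMeasure ((D : ℝ) - 1))

/-- The positive solutions in the space of polynomials of total degree at most `k`: those that are
nonnegative on `K` and have positive cell average. -/
def positiveSolutions {D : ℕ} (K : Set (EuclideanSpace ℝ (Fin D))) (k : ℕ) :
    Set (MvPolynomial (Fin D) ℝ) :=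
  {U | U.totalDegree ≤ k ∧ (∀ x ∈ K, 0 ≤ polyValue U x) ∧ 0 < cellAverage K U}

/-- The boundary crowding of `U`: the boundary average divided by the cell average. -/
def boundaryCrowding {D : ℕ} (K : Set (EuclideanSpace ℝ (Fin D)))
    (U : MvPolynomial (Fin D) ℝ) : ℝ :=
  boundaryAverage K U / cellAverage K U

/-- The optimal interior weight of `K` for polynomials of degree at most `k`: the supremum of the
boundary crowding over all positive solutions. -/
def optimalInteriorWeight {D : ℕ} (K : Set (EuclideanSpace ℝ (Fin D))) (k : ℕ) : ℝ :=
  sSup (boundaryCrowding K '' positiveSolutions K k)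

/-- The interior weight `(⌊k/2⌋ + 1) (⌊(k+1)/2⌋ + D) / D`; the divisions by `2` are those of
natural numbers. -/
def starWeight (D k : ℕ) : ℝ :=
  (((k / 2 : ℕ) : ℝ) + 1) * ((((k + 1) / 2 : ℕ) : ℝ) + (D : ℝ)) / (D : ℝ)

end

/-! Cut K into cones with apex c over the flat pieces of its boundary. Every piece lies at the same
height ρ from c, so writing y = c + t(x - c) turns the integral of U over K into κ times the
integral over x in ∂K of ∫₀¹ t^(D-1) U(c + t(x - c)) dt, with one constant κ for all pieces
(`exists_lintegral_eq_of_isStarRegularPolytope`). Taking U = 1 shows that κ cancels from the ratio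
of averages.

What remains is an inequality on each ray: a polynomial p of degree at most k that is nonnegative on
[0,1] satisfies p(1) ≤ D · `starWeight D k` · ∫₀¹ t^(D-1) p(t) dt
(`eval_one_le_integral_of_nonneg`). By a Markov–Lukács representation
(`mem_unitIntervalCone_of_nonneg`), p is a sum of terms t^a (1-t)^b A². Those with b > 0 vanish at
1. For the others the inequality is Cauchy–Schwarz against the reproducing kernel at 1 of the weight
t^e, whose value at 1 is (m+1)(m+e+1) (`sq_eval_one_le_integral`).

A regular simplex is cut out by inequalities on inner products with the vectors from its centroid to
its vertices, all of one length and with one common bound, so its facets are equidistant from the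
centroid. -/

/-! ### The reproducing kernel at the endpoint 1 for the weight t^e on [0,1] -/

open Polynomial Finset in
-- A Cauchy linear system, solved by partial fractions: the q j are the residues at the poles v j =
-- -(j+e+1) of a rational function taking the value 1 at 0, ..., m.
theorem exists_christoffel_coeffs (m e : ℕ) : ∃ q : ℕ → ℝ,
    (∀ i ∈ range (m + 1), ∑ j ∈ range (m + 1), q j / ((i : ℝ) + j + e + 1) = 1) ∧
    ∑ j ∈ range (m + 1), q j = ((m : ℝ) + 1) * (m + e + 1) := by
  set v : ℕ → ℝ := fun j => -((j : ℝ) + e + 1) with hv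
  have hinj : Set.InjOn v (range (m + 1)) := by
    intro a _ b _ h
    simpa [hv] using h
  -- Divided by ∏ (X - v j), this is 1 - ∏ (X - i) / ∏ (X - v j), which equals 1 at each i ≤ m. The
  -- leading terms cancel, so the degree is at most m and Lagrange interpolation at the poles
  -- recovers N.
  set N : ℝ[X] := ∏ j ∈ range (m + 1), (X - C (v j)) - ∏ i ∈ range (m + 1), (X - C (i : ℝ)) with hN
  have hmon1 : (∏ j ∈ range (m + 1), (X - C (v j))).Monic := monic_prod_X_sub_C _ _
  have hmon2 : (∏ i ∈ range (m + 1), (X - C ((i : ℕ) : ℝ))).Monic := monic_prod_X_sub_C _ _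
  have hdeg : N.degree < #(range (m + 1)) := by
    have hd1 : (∏ j ∈ range (m + 1), (X - C (v j))).degree = ((m + 1 : ℕ) : WithBot ℕ) := by
      rw [degree_prod]; simp
    have hd2 : (∏ i ∈ range (m + 1), (X - C ((i : ℕ) : ℝ))).degree = ((m + 1 : ℕ) : WithBot ℕ) := by
      rw [degree_prod]; simp only [degree_X_sub_C]; simp
    rw [card_range, ← hd1]
    exact degree_sub_lt_left (hd1.trans hd2.symm) hmon1.ne_zero
      (by rw [hmon1.leadingCoeff, hmon2.leadingCoeff])
  have hint := Lagrange.eq_interpolate hinj hdeg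
  rw [Lagrange.interpolate_eq_sum] at hint
  set q : ℕ → ℝ := fun j => eval (v j) N / ∏ l ∈ (range (m + 1)).erase j, (v j - v l) with hq
  refine ⟨q, fun i hi => ?_, ?_⟩
  · have h := congrArg (eval (i : ℝ)) hint
    have h0 : ∏ l ∈ range (m + 1), ((i : ℝ) - (l : ℝ)) = 0 := prod_eq_zero hi (sub_self _)
    have hpos : ∀ j : ℕ, 0 < (i : ℝ) - v j := fun j => by simp only [hv]; rw [sub_neg_eq_add]; positivity
    have hP : ∏ j ∈ range (m + 1), ((i : ℝ) - v j) ≠ 0 := prod_ne_zero_iff.2 fun j _ => (hpos j).ne'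
    rw [eval_finsetSum, hN, eval_sub, eval_prod, eval_prod] at h
    simp only [eval_sub, eval_X, eval_C, h0, sub_zero, eval_mul, eval_prod] at h
    apply mul_left_cancel₀ hP
    rw [mul_one, mul_sum]
    refine Eq.trans ?_ h.symm
    refine sum_congr rfl fun j hj => ?_
    rw [← mul_prod_erase _ _ hj]
    have h1 : (i : ℝ) + j + e + 1 = i - v j := by simp only [hv]; ring
    rw [h1]
    have := (hpos j).ne'
    simp only [hq, hN, eval_sub, eval_prod, eval_X, eval_C]
    field_simp
  -- The residues sum to the coefficient of X^m in N, a difference of sums of roots.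
  · have h := Lagrange.coeff_eq_sum hinj hdeg
    have c1 := prod_X_sub_C_coeff_card_pred (range (m + 1)) v (by simp)
    have c2 := prod_X_sub_C_coeff_card_pred (range (m + 1)) (fun i : ℕ => (i : ℝ)) (by simp)
    rw [← h, hN, coeff_sub, c1, c2]
    simp only [hv]
    have hs : ∀ n : ℕ, -∑ j ∈ range (n + 1), -((j : ℝ) + e + 1) - -∑ i ∈ range (n + 1), (i : ℝ) = (n + 1) * (n + e + 1) := by
      intro n
      induction n with
      | zero => simp
      | succ n ih => rw [sum_range_succ, sum_range_succ _ (n + 1)]; push_cast; linarith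
    exact hs m

open Polynomial in
/-- Reproducing kernel at `1` of the polynomials of degree at most `m` for the weight `t ^ e`. -/
theorem exists_christoffel_kernel (m e : ℕ) : ∃ q : ℝ[X],
    (∀ A : ℝ[X], A.natDegree ≤ m → ∫ t in (0 : ℝ)..1, A.eval t * q.eval t * t ^ e = A.eval 1) ∧
    q.natDegree ≤ m ∧ q.eval 1 = ((m : ℝ) + 1) * (m + e + 1) := by
  obtain ⟨q, hq1, hq2⟩ := exists_christoffel_coeffs m e
  refine ⟨∑ j ∈ Finset.range (m + 1), C (q j) * X ^ j, fun A hA => ?_, ?_, ?_⟩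
  · have hA' := A.as_sum_range_C_mul_X_pow' (Nat.lt_succ_of_le hA)
    have : ∀ t : ℝ, A.eval t * (∑ j ∈ Finset.range (m + 1), C (q j) * X ^ j).eval t * t ^ e =
        ∑ i ∈ Finset.range (m + 1), ∑ j ∈ Finset.range (m + 1),
          A.coeff i * q j * t ^ (i + j + e) := by
      intro t
      conv_lhs => rw [hA']
      simp only [eval_finsetSum, eval_mul, eval_C, eval_pow, eval_X]
      rw [Finset.sum_mul_sum, Finset.sum_mul]
      refine Finset.sum_congr rfl fun i _ => ?_
      rw [Finset.sum_mul]
      refine Finset.sum_congr rfl fun j _ => ?_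
      ring
    simp only [this]
    rw [intervalIntegral.integral_finsetSum fun i _ => Continuous.intervalIntegrable (by fun_prop) _ _]
    conv_rhs => rw [hA']
    simp only [eval_finsetSum, eval_mul, eval_C, eval_pow, eval_X, one_pow, mul_one]
    refine Finset.sum_congr rfl fun i hi => ?_
    rw [intervalIntegral.integral_finsetSum fun i _ => Continuous.intervalIntegrable (by fun_prop) _ _]
    refine Eq.trans ?_ ((congrArg (A.coeff i * ·) (hq1 i hi)).trans (mul_one _))
    simp only [Finset.mul_sum]
    refine Finset.sum_congr rfl fun j _ => ?_
    rw [intervalIntegral.integral_const_mul, integral_pow]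
    simp
    ring
  · refine natDegree_sum_le_of_forall_le _ _ fun j hj => ?_
    exact (natDegree_C_mul_X_pow_le _ _).trans (Nat.lt_succ_iff.1 (Finset.mem_range.1 hj))
  · simp [eval_finsetSum, hq2]

open Polynomial in
-- Cauchy–Schwarz for A and the kernel q, whose squared norm is q(1) = M by the reproducing property
-- applied to q itself.
theorem sq_eval_one_le_integral (m e : ℕ) (A : ℝ[X]) (hA : A.natDegree ≤ m) :
    (A.eval 1) ^ 2 ≤ ((m : ℝ) + 1) * (m + e + 1) * ∫ t in (0 : ℝ)..1, A.eval t ^ 2 * t ^ e := by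
  obtain ⟨q, hq, hqd, hq1⟩ := exists_christoffel_kernel m e
  set M : ℝ := ((m : ℝ) + 1) * (m + e + 1) with hM
  have hMpos : 0 < M := by positivity
  set a := A.eval 1
  have h0 : 0 ≤ ∫ t in (0 : ℝ)..1, (M * A.eval t - a * q.eval t) ^ 2 * t ^ e :=
    intervalIntegral.integral_nonneg zero_le_one fun t ht => by
      have := ht.1
      positivity
  have h1 : ∀ t : ℝ, (M * A.eval t - a * q.eval t) ^ 2 * t ^ e =
      M ^ 2 * (A.eval t ^ 2 * t ^ e) - 2 * M * a * (A.eval t * q.eval t * t ^ e) +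
        a ^ 2 * (q.eval t * q.eval t * t ^ e) := fun t => by ring
  simp only [h1] at h0
  rw [intervalIntegral.integral_add (Continuous.intervalIntegrable (by fun_prop) _ _)
      (Continuous.intervalIntegrable (by fun_prop) _ _),
    intervalIntegral.integral_sub (Continuous.intervalIntegrable (by fun_prop) _ _)
      (Continuous.intervalIntegrable (by fun_prop) _ _), intervalIntegral.integral_const_mul,
    intervalIntegral.integral_const_mul, intervalIntegral.integral_const_mul, hq A hA, hq q hqd,
    hq1] at h0
  have : 0 ≤ M * (M * (∫ t in (0 : ℝ)..1, A.eval t ^ 2 * t ^ e) - a ^ 2) := by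
    linarith
  linarith [nonneg_of_mul_nonneg_right this hMpos]

/-! ### Polynomials nonnegative on the unit interval -/

open Polynomial in
/-- The cone spanned by the polynomials `t ^ a * (1 - t) ^ b * A ^ 2` of formal degree at most `k`. -/
noncomputable def unitIntervalCone (k : ℕ) : AddSubmonoid ℝ[X] :=
  AddSubmonoid.closure
    {g | ∃ (a b : ℕ) (A : ℝ[X]), a + b + 2 * A.natDegree ≤ k ∧ g = X ^ a * (1 - X) ^ b * A ^ 2}

open Polynomial in
theorem mem_unitIntervalCone {k a b : ℕ} {A : ℝ[X]} (h : a + b + 2 * A.natDegree ≤ k) :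
    X ^ a * (1 - X) ^ b * A ^ 2 ∈ unitIntervalCone k :=
  AddSubmonoid.subset_closure ⟨a, b, A, h, rfl⟩

open Polynomial in
theorem mul_mem_unitIntervalCone {k l n : ℕ} {p q : ℝ[X]} (hp : p ∈ unitIntervalCone k)
    (hq : q ∈ unitIntervalCone l) (h : k + l ≤ n) : p * q ∈ unitIntervalCone n := by
  have h1 := AddSubmonoid.mul_mem_mul hp hq
  rw [unitIntervalCone, unitIntervalCone, AddSubmonoid.closure_mul_closure] at h1
  refine AddSubmonoid.closure_mono ?_ h1
  rintro _ ⟨_, ⟨a, b, A, h1, rfl⟩, _, ⟨a', b', A', h2, rfl⟩, rfl⟩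
  refine ⟨a + a', b + b', A * A', ?_, by ring⟩
  have := natDegree_mul_le (p := A) (q := A')
  omega

open Polynomial in
theorem C_mem_unitIntervalCone {r : ℝ} (hr : 0 ≤ r) (k : ℕ) : C r ∈ unitIntervalCone k := by
  have := mem_unitIntervalCone (k := k) (a := 0) (b := 0) (A := C √r) (by simp)
  simpa [← C_pow, Real.sq_sqrt hr] using this

open Polynomial in
-- If q were negative somewhere, it would be negative on a nonempty open part of (0,1), where g
-- would have to vanish.
theorem nonneg_of_mul_nonneg_unitInterval {g q : ℝ[X]} (hg0 : g ≠ 0)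
    (hg : ∀ x ∈ Set.Icc (0 : ℝ) 1, 0 ≤ g.eval x)
    (h : ∀ x ∈ Set.Icc (0 : ℝ) 1, 0 ≤ (g * q).eval x) :
    ∀ x ∈ Set.Icc (0 : ℝ) 1, 0 ≤ q.eval x := by
  by_contra! hx
  obtain ⟨x, hx, hqx⟩ := hx
  have hopen : IsOpen {y | q.eval y < 0} := isOpen_lt q.continuous continuous_const
  rw [← closure_Ioo zero_ne_one] at hx
  obtain ⟨y, hy⟩ := mem_closure_iff.1 hx _ hopen hqx
  have hmem := (hopen.inter isOpen_Ioo).mem_nhds hy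
  refine hg0 (eq_zero_of_infinite_isRoot g ((infinite_of_mem_nhds y hmem).mono fun z hz => ?_))
  have hz' := Set.Ioo_subset_Icc_self hz.2
  have h1 := h z hz'
  rw [eval_mul] at h1
  have hz1 : q.eval z < 0 := hz.1
  exact le_antisymm (by nlinarith [hg z hz']) (hg z hz')

open Polynomial in
-- Induction on the degree: a complex root of p supplies a factor of degree 1 or 2 that lies in the
-- cone, and the quotient is again nonnegative. The cones are multiplicative with additive degrees.
theorem mem_unitIntervalCone_of_nonneg (k : ℕ) : ∀ p : ℝ[X], p.natDegree ≤ k →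
    (∀ x ∈ Set.Icc (0 : ℝ) 1, 0 ≤ p.eval x) → p ∈ unitIntervalCone k := by
  induction k using Nat.strong_induction_on with
  | _ k ih =>
  intro p hpk hp
  by_cases hp0 : p.natDegree = 0
  · obtain ⟨r, rfl⟩ := natDegree_eq_zero.1 hp0
    exact C_mem_unitIntervalCone (by simpa using hp 0 (by simp)) k
  have hne : p ≠ 0 := by rintro rfl; simp at hp0
  -- divide out a factor that is nonnegative on the unit interval
  have step : ∀ (g : ℝ[X]) (d : ℕ), g.natDegree = d → 0 < d → g ∣ p → g ∈ unitIntervalCone d →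
      (∀ x ∈ Set.Icc (0 : ℝ) 1, 0 ≤ g.eval x) → p ∈ unitIntervalCone k := by
    rintro g d hgd hd ⟨q, hq⟩ hgc hg
    have hg0 : g ≠ 0 := by rintro rfl; simp at hgd; omega
    have hq0 : q ≠ 0 := by rintro rfl; simp at hq; exact hne hq
    have hdeg : p.natDegree = d + q.natDegree := by rw [hq, natDegree_mul hg0 hq0, hgd]
    have hqn := nonneg_of_mul_nonneg_unitInterval hg0 hg (q := q) (by rwa [← hq])
    rw [hq]
    exact mul_mem_unitIntervalCone hgc (ih (k - d) (by omega) q (by omega) hqn) (by omega)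
  -- Linear factors nonnegative on [0,1], written through their values s at 0 and r at 1.
  have lin : ∀ (r s : ℝ), 0 ≤ r → 0 ≤ s → C r * X + C s * (1 - X) ∈ unitIntervalCone 1 := by
    intro r s hr hs
    have h1 := mem_unitIntervalCone (k := 1) (a := 1) (b := 0) (A := C √r) (by simp)
    have h2 := mem_unitIntervalCone (k := 1) (a := 0) (b := 1) (A := C √s) (by simp)
    rw [← C_pow, Real.sq_sqrt hr] at h1
    rw [← C_pow, Real.sq_sqrt hs] at h2
    have := add_mem h1 h2
    simp only [pow_one, pow_zero, one_mul, mul_one] at this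
    rwa [mul_comm X, mul_comm (1 - X)] at this
  obtain ⟨z, hz⟩ := IsAlgClosed.exists_aeval_eq_zero ℂ p
    (by rw [degree_eq_natDegree hne]; exact_mod_cast hp0)
  by_cases him : z.im = 0
  · obtain ⟨a, rfl⟩ : ∃ a : ℝ, (a : ℂ) = z := ⟨z.re, Complex.ext rfl (by simp [him])⟩
    have ha : p.eval a = 0 := by
      have : (algebraMap ℝ ℂ) (p.eval a) = 0 := by rw [← hz]; simp [aeval_algebraMap_apply_eq_algebraMap_eval, ← Complex.coe_algebraMap]
      simpa using this
    have hdvd : X - C a ∣ p := dvd_iff_isRoot.2 ha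
    rcases le_or_gt a 0 with h | h
    · refine step (X - C a) 1 (natDegree_X_sub_C a) one_pos hdvd ?_ fun x hx => ?_
      · have := lin (1 - a) (-a) (by linarith) (by linarith)
        convert this using 1
        simp only [C_sub, C_neg, C_1]; ring
      · simp; linarith [hx.1]
    rcases le_or_gt 1 a with h' | h'
    · refine step (C a - X) 1 ?_ one_pos ?_ ?_ fun x hx => ?_
      · rw [← neg_sub, natDegree_neg, natDegree_X_sub_C]
      · rw [← neg_sub]; exact (neg_dvd).2 hdvd
      · have := lin (a - 1) a (by linarith) (by linarith)
        convert this using 1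
        simp only [C_sub, C_1]; ring
      · simp; linarith [hx.2]
    · obtain ⟨q, hq⟩ := hdvd
      -- A root inside (0,1) is a minimum of p, hence a double root, and a square can be divided
      -- out.
      have hmin : IsLocalMin (fun x => p.eval x) a := by
        filter_upwards [Icc_mem_nhds h h'] with x hx
        rw [ha]; exact hp x hx
      have hder := hmin.deriv_eq_zero
      rw [Polynomial.deriv, hq] at hder
      simp at hder
      obtain ⟨r, hr⟩ : X - C a ∣ q := dvd_iff_isRoot.2 hder
      refine step ((X - C a) ^ 2) 2 (by simp [natDegree_pow]) two_pos ⟨r, ?_⟩ ?_ fun x hx => ?_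
      · rw [hq, hr]; ring
      · simpa using mem_unitIntervalCone (k := 2) (a := 0) (b := 0) (A := X - C a) (by simp)
      · simp; positivity
  · have hQ : X ^ 2 - C (2 * z.re) * X + C (‖z‖ ^ 2) =
        (X - C z.re) ^ 2 + C (z.im ^ 2) := by
      have : ‖z‖ ^ 2 = z.re ^ 2 + z.im ^ 2 := by rw [← Complex.normSq_eq_norm_sq, Complex.normSq_apply]; ring
      rw [this]; simp only [C_add, C_mul, C_pow]; rw [show (C 2 : ℝ[X]) = 2 from rfl]; ring
    have hdvd := p.quadratic_dvd_of_aeval_eq_zero_im_ne_zero hz him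
    rw [hQ] at hdvd
    refine step _ 2 ?_ two_pos hdvd (add_mem ?_ (C_mem_unitIntervalCone (sq_nonneg _) 2)) fun x _ => ?_
    · rw [natDegree_add_C]; simp [natDegree_pow]
    · simpa using mem_unitIntervalCone (k := 2) (a := 0) (b := 0) (A := X - C z.re) (by simp)
    · simp; positivity

/-! ### The one-variable inequality -/

open Polynomial in
/-- A polynomial that is nonnegative on `[0, 1]` is bounded at `1` by its weighted mean. -/
theorem eval_one_le_integral_of_nonneg (k d : ℕ) (p : ℝ[X]) (hpk : p.natDegree ≤ k)
    (hp : ∀ x ∈ Set.Icc (0 : ℝ) 1, 0 ≤ p.eval x) :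
    p.eval 1 ≤ (((k / 2 : ℕ) : ℝ) + 1) * ((((k + 1) / 2 : ℕ) : ℝ) + ((d + 1 : ℕ) : ℝ)) *
      ∫ t in (0 : ℝ)..1, t ^ d * p.eval t := by
  have hmem := mem_unitIntervalCone_of_nonneg k p hpk hp
  clear hp hpk
  induction hmem using AddSubmonoid.closure_induction with
  | zero => simp
  | add p q _ _ hp hq =>
    have hsum : ∀ t : ℝ, t ^ d * (p + q).eval t = t ^ d * p.eval t + t ^ d * q.eval t :=
      fun t => by rw [eval_add, mul_add]
    simp only [hsum]
    rw [eval_add, intervalIntegral.integral_add (Continuous.intervalIntegrable (by fun_prop) _ _)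
      (Continuous.intervalIntegrable (by fun_prop) _ _), mul_add]
    exact add_le_add hp hq
  | mem g hg =>
    obtain ⟨a, b, A, hab, rfl⟩ := hg
    have hnn : 0 ≤ ∫ t in (0 : ℝ)..1, t ^ d * (X ^ a * (1 - X) ^ b * A ^ 2 : ℝ[X]).eval t :=
      intervalIntegral.integral_nonneg zero_le_one fun t ht => by
        have h0 := ht.1
        have h1 : 0 ≤ 1 - t := by linarith [ht.2]
        simp; positivity
    rcases Nat.eq_zero_or_pos b with rfl | hb
    -- The parity of a goes into the weight: t^a A² = t^(a % 2) (t^(a/2) A)².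
    · have h := sq_eval_one_le_integral (A.natDegree + a / 2) (d + a % 2) (X ^ (a / 2) * A)
        ((natDegree_mul_le).trans (by simp [add_comm]))
      have h2 : ∀ t : ℝ, (X ^ (a / 2) * A).eval t ^ 2 * t ^ (d + a % 2) =
          t ^ d * (X ^ a * (1 - X) ^ 0 * A ^ 2 : ℝ[X]).eval t := by
        intro t
        have : t ^ a = (t ^ (a / 2)) ^ 2 * t ^ (a % 2) := by
          rw [← pow_mul, ← pow_add]; congr 1; omega
        simp only [eval_mul, eval_pow, eval_X, pow_zero, mul_one, this]
        ring
      simp only [h2] at h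
      have h3 : (X ^ a * (1 - X) ^ 0 * A ^ 2 : ℝ[X]).eval 1 = (X ^ (a / 2) * A).eval 1 ^ 2 := by simp
      rw [h3]
      refine h.trans (mul_le_mul_of_nonneg_right ?_ hnn)
      have e1 : A.natDegree + a / 2 ≤ k / 2 := by omega
      -- a/2 + a % 2 is a/2 rounded up, which accounts for ⌊(k+1)/2⌋ in the second factor against
      -- ⌊k/2⌋ in the first.
      have e2 : A.natDegree + a / 2 + (d + a % 2) + 1 ≤ (k + 1) / 2 + (d + 1) := by omega
      refine mul_le_mul ?_ ?_ (by positivity) (by positivity)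
      · have : ((A.natDegree + a / 2 : ℕ) : ℝ) ≤ (k / 2 : ℕ) := by exact_mod_cast e1
        linarith
      · exact_mod_cast e2
    · have : (X ^ a * (1 - X) ^ b * A ^ 2 : ℝ[X]).eval 1 = 0 := by simp [hb.ne']
      rw [this]
      exact mul_nonneg (by positivity) hnn

/-! ### Polar coordinates relative to a hyperplane -/

section

open scoped ENNReal

theorem lintegral_comp_smul_addHaar {E : Type*} [NormedAddCommGroup E] [NormedSpace ℝ E]
    [MeasurableSpace E] [BorelSpace E] [FiniteDimensional ℝ E] (μ : Measure E) [μ.IsAddHaarMeasure]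
    {r : ℝ} (hr : 0 < r) (G : E → ℝ≥0∞) :
    ∫⁻ z, G z ∂μ = ENNReal.ofReal (r ^ Module.finrank ℝ E) * ∫⁻ z, G (r • z) ∂μ := by
  have h := lintegral_map_equiv (μ := μ) G (Homeomorph.smulOfNeZero r hr.ne').toMeasurableEquiv
  have h2 : Measure.map (Homeomorph.smulOfNeZero r hr.ne').toMeasurableEquiv μ =
      ENNReal.ofReal (abs (r ^ Module.finrank ℝ E)⁻¹) • μ := Measure.map_addHaar_smul μ hr.ne'
  rw [h2, lintegral_smul_measure] at h
  have h3 : ∫⁻ z, G (r • z) ∂μ = ENNReal.ofReal (abs (r ^ Module.finrank ℝ E)⁻¹) * ∫⁻ z, G z ∂μ :=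
    h.symm
  have hp : 0 < r ^ Module.finrank ℝ E := by positivity
  rw [h3, ← mul_assoc, ← ENNReal.ofReal_mul hp.le, abs_of_pos (by positivity),
    mul_inv_cancel₀ hp.ne', ENNReal.ofReal_one, one_mul]

/-- Orthonormal coordinates adapted to a hyperplane with unit normal `n`. -/
theorem exists_hyperplane_chart {d : ℕ} (n : EuclideanSpace ℝ (Fin (d + 1))) (hn : ‖n‖ = 1) :
    ∃ ι : EuclideanSpace ℝ (Fin d) →ₗᵢ[ℝ] EuclideanSpace ℝ (Fin (d + 1)),
      (∀ z, inner ℝ n (ι z) = 0) ∧ (∀ x, inner ℝ n x = 0 → ∃ z, ι z = x) ∧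
      MeasurePreserving (fun p : ℝ × EuclideanSpace ℝ (Fin d) => p.1 • n + ι p.2) := by
  have hn0 : n ≠ 0 := by rintro rfl; simp at hn
  have : Fact (Module.finrank ℝ (EuclideanSpace ℝ (Fin (d + 1))) = d + 1) := ⟨by simp⟩
  let b := OrthonormalBasis.fromOrthogonalSpanSingleton (𝕜 := ℝ) d hn0
  let ι : EuclideanSpace ℝ (Fin d) →ₗᵢ[ℝ] EuclideanSpace ℝ (Fin (d + 1)) :=
    (Submodule.subtypeₗᵢ _).comp b.repr.symm.toLinearIsometry
  have hι : ∀ z, inner ℝ n (ι z) = 0 := fun z =>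
    (Submodule.mem_orthogonal_singleton_iff_inner_right).1 (b.repr.symm z).2
  refine ⟨ι, hι, fun x hx => ?_, ?_⟩
  · refine ⟨b.repr ⟨x, Submodule.mem_orthogonal_singleton_iff_inner_right.2 hx⟩, ?_⟩
    simp [ι]
  -- With the L² norm on the product the chart is a linear isometry, hence volume preserving.
  · let f : WithLp 2 (ℝ × EuclideanSpace ℝ (Fin d)) →ₗ[ℝ] EuclideanSpace ℝ (Fin (d + 1)) :=
      { toFun := fun p => p.fst • n + ι p.snd
        map_add' := fun p q => by simp [add_smul]; abel
        map_smul' := fun r p => by simp [mul_smul] }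
    have hf : ∀ p, ‖f p‖ = ‖p‖ := by
      intro p
      rw [← sq_eq_sq₀ (norm_nonneg _) (norm_nonneg _), WithLp.prod_norm_sq_eq_of_L2]
      change ‖p.fst • n + ι p.snd‖ ^ 2 = _
      rw [norm_add_sq_real, inner_smul_left, hι, norm_smul, hn, ι.norm_map]
      simp
    have hfr : Module.finrank ℝ (WithLp 2 (ℝ × EuclideanSpace ℝ (Fin d))) =
        Module.finrank ℝ (EuclideanSpace ℝ (Fin (d + 1))) := by
      rw [(WithLp.linearEquiv 2 ℝ (ℝ × EuclideanSpace ℝ (Fin d))).finrank_eq]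
      simp [add_comm]
    have := (LinearIsometry.toLinearIsometryEquiv ⟨f, hf⟩ hfr).measurePreserving.comp
      (WithLp.volume_preserving_toLp (U := ℝ) (V := EuclideanSpace ℝ (Fin d)))
    exact this

/-- The normalisation a need not be computed: it cancels from the averages. -/
theorem exists_volume_eq_smul_hausdorffMeasure (d : ℕ) : ∃ a : ℝ≥0∞, a ≠ 0 ∧ a ≠ ∞ ∧
    (volume : Measure (EuclideanSpace ℝ (Fin d))) = a • Measure.hausdorffMeasure (d : ℝ) :=
  ⟨Measure.addHaarScalarFactor (volume : Measure (EuclideanSpace ℝ (Fin d)))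
      (Measure.hausdorffMeasure (d : ℝ)),
    by simpa using Measure.addHaarScalarFactor_volume_hausdorffMeasure_ne_zero d, by simp,
    Measure.isAddLeftInvariant_eq_smul _ _⟩

theorem restrict_hausdorffMeasure_hyperplane {d : ℕ} {n : EuclideanSpace ℝ (Fin (d + 1))}
    (hn : ‖n‖ = 1) {ι : EuclideanSpace ℝ (Fin d) →ₗᵢ[ℝ] EuclideanSpace ℝ (Fin (d + 1))}
    (h1 : ∀ z, inner ℝ n (ι z) = 0) (h2 : ∀ x, inner ℝ n x = 0 → ∃ z, ι z = x)
    (c : EuclideanSpace ℝ (Fin (d + 1))) (s : ℝ) :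
    (Measure.hausdorffMeasure (d : ℝ)).restrict {x | inner ℝ n (x - c) = s} =
      Measure.map (fun z => c + (s • n + ι z)) (Measure.hausdorffMeasure (d : ℝ)) := by
  have hiso : Isometry (fun z => c + (s • n + ι z)) :=
    (IsometryEquiv.addLeft c).isometry.comp
      ((IsometryEquiv.addLeft (s • n)).isometry.comp ι.isometry)
  rw [hiso.map_hausdorffMeasure (Or.inl (Nat.cast_nonneg d))]
  congr 1
  ext x
  constructor
  · intro hx
    obtain ⟨z, hz⟩ := h2 (x - c - s • n) (by
      rw [inner_sub_right, hx, inner_smul_right, real_inner_self_eq_norm_sq, hn]; simp)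
    exact ⟨z, by simp only [hz]; abel⟩
  · rintro ⟨z, rfl⟩
    simp only [Set.mem_ofPred_eq, add_sub_cancel_left]
    rw [inner_add_right, h1, inner_smul_right, real_inner_self_eq_norm_sq, hn]; simp

/-- Fubini over the levels r of ⟨n, y - c⟩, then r = s t and z ↦ t z. The Jacobians are s and t^d.
-/
theorem lintegral_halfspace_eq_chart {d : ℕ} {n : EuclideanSpace ℝ (Fin (d + 1))}
    (hn : ‖n‖ = 1) {ι : EuclideanSpace ℝ (Fin d) →ₗᵢ[ℝ] EuclideanSpace ℝ (Fin (d + 1))}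
    (h1 : ∀ z, inner ℝ n (ι z) = 0)
    (h3 : MeasurePreserving (fun p : ℝ × EuclideanSpace ℝ (Fin d) => p.1 • n + ι p.2))
    (c : EuclideanSpace ℝ (Fin (d + 1))) {s : ℝ} (hs : 0 < s)
    {G : EuclideanSpace ℝ (Fin (d + 1)) → ℝ≥0∞} (hG : Measurable G) :
    ∫⁻ y in {y | 0 < inner ℝ n (y - c)}, G y =
      ENNReal.ofReal s * ∫⁻ z, ∫⁻ t in Set.Ioi (0 : ℝ),
        ENNReal.ofReal (t ^ d) * G (c + t • (s • n + ι z)) := by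
  have hι : Measurable ι := ι.continuous.measurable
  have hS : MeasurableSet {y : EuclideanSpace ℝ (Fin (d + 1)) | 0 < inner ℝ n (y - c)} :=
    (isOpen_lt continuous_const (by fun_prop)).measurableSet
  rw [← lintegral_indicator hS, ← lintegral_add_left_eq_self _ c,
    ← h3.lintegral_comp (f := fun y => Set.indicator {y | 0 < inner ℝ n (y - c)} G (c + y))
      ((hG.indicator hS).comp (measurable_const_add c)), Measure.volume_eq_prod,
    lintegral_prod _ (Measurable.aemeasurable ?_)]
  swap
  · exact (hG.indicator hS).comp (by fun_prop)
  have hin : ∀ (r : ℝ) z, inner ℝ n (c + (r • n + ι z) - c) = r := fun r z => by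
    rw [add_sub_cancel_left, inner_add_right, h1, inner_smul_right, real_inner_self_eq_norm_sq, hn]
    simp
  have hind : ∀ (r : ℝ) z, Set.indicator {y | 0 < inner ℝ n (y - c)} G (c + (r • n + ι z)) =
      Set.indicator (Set.Ioi 0) (fun r => G (c + (r • n + ι z))) r := by
    intro r z
    simp only [Set.indicator, Set.mem_ofPred_eq, hin, Set.mem_Ioi]
  simp only [hind]
  rw [lintegral_comp_smul_addHaar volume hs]
  simp only [Module.finrank_self, pow_one]
  congr 1
  have hscale : ∀ t : ℝ, ∫⁻ z, Set.indicator (Set.Ioi 0) (fun r => G (c + (r • n + ι z))) (s • t) =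
      Set.indicator (Set.Ioi 0)
        (fun t => ∫⁻ z, ENNReal.ofReal (t ^ d) * G (c + t • (s • n + ι z))) t := by
    intro t
    by_cases ht : 0 < t
    · have hst : s • t ∈ Set.Ioi (0 : ℝ) := by simpa using mul_pos hs ht
      simp only [Set.indicator_of_mem hst, Set.indicator_of_mem (Set.mem_Ioi.2 ht)]
      rw [lintegral_comp_smul_addHaar volume ht, lintegral_const_mul]
      · simp only [finrank_euclideanSpace, Fintype.card_fin, map_smul, smul_add, smul_smul,
          smul_eq_mul, mul_comm s t]
      · exact hG.comp (by fun_prop)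
    · have hst : s • t ∉ Set.Ioi (0 : ℝ) := by
        simpa using mul_nonpos_of_nonneg_of_nonpos hs.le (not_lt.1 ht)
      simp only [Set.indicator_of_notMem hst, Set.indicator_of_notMem (s := Set.Ioi (0:ℝ)) (a := t) (by simpa using ht), lintegral_zero]
  simp only [hscale]
  rw [lintegral_indicator measurableSet_Ioi, lintegral_lintegral_swap]
  refine Measurable.aemeasurable ?_
  refine Measurable.mul (by fun_prop) (hG.comp (by fun_prop))

/-- Polar coordinates about `c` with respect to a hyperplane at distance `s` from `c`. -/
theorem exists_lintegral_halfspace_const (d : ℕ) : ∃ a : ℝ≥0∞, a ≠ 0 ∧ a ≠ ∞ ∧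
    ∀ (c n : EuclideanSpace ℝ (Fin (d + 1))) (s : ℝ), ‖n‖ = 1 → 0 < s →
    ∀ G : EuclideanSpace ℝ (Fin (d + 1)) → ℝ≥0∞, Measurable G →
    ∫⁻ y in {y | 0 < inner ℝ n (y - c)}, G y =
      ENNReal.ofReal s * a * ∫⁻ x in {x | inner ℝ n (x - c) = s},
        (∫⁻ t in Set.Ioi (0 : ℝ), ENNReal.ofReal (t ^ d) * G (c + t • (x - c)))
          ∂(Measure.hausdorffMeasure (d : ℝ)) := by
  obtain ⟨a, ha0, ha, hvol⟩ := exists_volume_eq_smul_hausdorffMeasure d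
  refine ⟨a, ha0, ha, fun c n s hn hs G hG => ?_⟩
  obtain ⟨ι, h1, h2, h3⟩ := exists_hyperplane_chart n hn
  have hι : Measurable ι := ι.continuous.measurable
  rw [lintegral_halfspace_eq_chart hn h1 h3 c hs hG, restrict_hausdorffMeasure_hyperplane hn h1 h2,
    lintegral_map _ (by fun_prop), hvol, lintegral_smul_measure, smul_eq_mul, mul_assoc]
  · simp only [add_sub_cancel_left]
  · refine Measurable.lintegral_prod_right' (f := fun p : EuclideanSpace ℝ (Fin (d + 1)) × ℝ =>
      ENNReal.ofReal (p.2 ^ d) * G (c + p.2 • (p.1 - c))) ?_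
    refine Measurable.mul (by fun_prop) (hG.comp (by fun_prop))

/-- In a chart of the first hyperplane the intersection is an affine subspace, proper by `h`. -/
theorem hausdorffMeasure_hyperplane_inter_eq_zero {d : ℕ}
    {n n' : EuclideanSpace ℝ (Fin (d + 1))} {s s' : ℝ} (hn : ‖n‖ = 1)
    (h : ¬ {x | inner ℝ n x = s} ⊆ {x | inner ℝ n' x = s'}) :
    Measure.hausdorffMeasure (d : ℝ) ({x | inner ℝ n x = s} ∩ {x | inner ℝ n' x = s'}) = 0 := by
  obtain ⟨ι, h1, h2, h3⟩ := exists_hyperplane_chart n hn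
  have hι : Measurable ι := ι.continuous.measurable
  have hm : MeasurableSet {x : EuclideanSpace ℝ (Fin (d + 1)) | inner ℝ n' x = s'} :=
    (isClosed_eq (by fun_prop) continuous_const).measurableSet
  have hr := restrict_hausdorffMeasure_hyperplane hn h1 h2 0 s
  simp only [sub_zero, zero_add] at hr
  rw [Set.inter_comm, ← Measure.restrict_apply hm, hr, Measure.map_apply (by fun_prop) hm]
  let A : EuclideanSpace ℝ (Fin d) →ᵃ[ℝ] ℝ :=
    ((innerSL ℝ n').toLinearMap ∘ₗ ι.toLinearMap).toAffineMap + AffineMap.const ℝ _ (inner ℝ n' (s • n))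
  let S : AffineSubspace ℝ (EuclideanSpace ℝ (Fin d)) := (AffineSubspace.mk' s' ⊥).comap A
  have hS : (fun z => s • n + ι z) ⁻¹' {x | inner ℝ n' x = s'} = S := by
    ext z
    simp [S, A, AffineSubspace.mem_mk', inner_add_right, sub_eq_zero, add_comm]
  rw [hS]
  refine Measure.addHaar_affineSubspace _ _ fun htop => h fun x hx => ?_
  obtain ⟨z, hz⟩ := h2 (x - s • n) (by
    rw [inner_sub_right, hx, inner_smul_right, real_inner_self_eq_norm_sq, hn]; simp)
  have : z ∈ (fun z => s • n + ι z) ⁻¹' {x | inner ℝ n' x = s'} := by rw [hS, htop]; trivial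
  simpa [hz] using this

end

/-! ### Outward normals and the flat part of the boundary -/

section

open Topology Filter Set

theorem eventually_add_smul_nhdsGT {E : Type*} [NormedAddCommGroup E] [NormedSpace ℝ E] {x : E}
    {P : E → Prop} (h : ∀ᶠ y in 𝓝 x, P y) (v : E) : ∀ᶠ t in 𝓝[>] (0 : ℝ), P (x + t • v) := by
  have : Tendsto (fun t : ℝ => x + t • v) (𝓝[>] 0) (𝓝 x) := by
    have h1 : Tendsto (fun t : ℝ => x + t • v) (𝓝 0) (𝓝 (x + (0 : ℝ) • v)) :=
      Continuous.tendsto (by fun_prop) 0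
    rw [zero_smul, add_zero] at h1
    exact h1.mono_left nhdsWithin_le_nhds
  exact this.eventually h

/-- The frontier clause is automatic: x satisfies the local inequality, while x + t n violates it
for t > 0. -/
theorem isOutwardUnitNormal_iff {D : ℕ} {K : Set (EuclideanSpace ℝ (Fin D))}
    {x n : EuclideanSpace ℝ (Fin D)} :
    IsOutwardUnitNormal K x n ↔ ‖n‖ = 1 ∧ ∀ᶠ y in 𝓝 x, (y ∈ K ↔ inner ℝ n (y - x) ≤ 0) := by
  have hball : (∃ ε > 0, ∀ y ∈ Metric.ball x ε, (y ∈ K ↔ inner ℝ n (y - x) ≤ 0)) ↔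
      ∀ᶠ y in 𝓝 x, (y ∈ K ↔ inner ℝ n (y - x) ≤ 0) := Metric.eventually_nhds_iff_ball.symm
  rw [IsOutwardUnitNormal, hball]
  refine ⟨fun h => h.2, fun h => ⟨?_, h⟩⟩
  obtain ⟨hn, h⟩ := h
  refine ⟨subset_closure (h.self_of_nhds.2 (by simp)), fun hx => ?_⟩
  have h1 := h.and (mem_interior_iff_mem_nhds.1 hx)
  obtain ⟨t, ht, ht0⟩ := ((eventually_add_smul_nhdsGT h1 n).and self_mem_nhdsWithin).exists
  have h2 := ht.1.1 ht.2
  rw [add_sub_cancel_left, inner_smul_right, real_inner_self_eq_norm_sq, hn] at h2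
  have : 0 < t := ht0
  linarith

/-- Testing the direction n' - n forces ⟨n, n'⟩ = 1, the equality case of Cauchy–Schwarz. -/
theorem eq_of_eventually_inner_nonpos_imp {E : Type*} [NormedAddCommGroup E]
    [InnerProductSpace ℝ E] {x n n' : E} (hn : ‖n‖ = 1) (hn' : ‖n'‖ = 1)
    (h : ∀ᶠ y in 𝓝 x, inner ℝ n (y - x) ≤ 0 → inner ℝ n' (y - x) ≤ 0) : n = n' := by
  obtain ⟨t, ht, ht0⟩ :=
    ((eventually_add_smul_nhdsGT h (n' - n)).and self_mem_nhdsWithin).exists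
  have ht0 : 0 < t := ht0
  simp only [add_sub_cancel_left, inner_smul_right, inner_sub_right, real_inner_self_eq_norm_sq,
    hn, hn'] at ht
  have h2 : inner ℝ n n' ≤ 1 := by simpa [hn, hn'] using real_inner_le_norm n n'
  have h3 := ht (mul_nonpos_of_nonneg_of_nonpos ht0.le (by linarith))
  rw [real_inner_comm n n'] at h3
  have h4 : inner ℝ n n' = 1 := by nlinarith
  exact (inner_eq_one_iff_of_norm_eq_one hn hn').1 h4

theorem IsOutwardUnitNormal.eq {D : ℕ} {K : Set (EuclideanSpace ℝ (Fin D))}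
    {x n n' : EuclideanSpace ℝ (Fin D)} (h : IsOutwardUnitNormal K x n)
    (h' : IsOutwardUnitNormal K x n') : n = n' := by
  rw [isOutwardUnitNormal_iff] at h h'
  refine eq_of_eventually_inner_nonpos_imp (x := x) h.1 h'.1 ?_
  filter_upwards [h.2, h'.2] with y hy hy' using fun hle => hy'.1 (hy.2 hle)

/-- Since ⟨n, x - c⟩ is constant, the local half-space does not depend on x, and the set is a
hyperplane intersected with an open set. -/
theorem measurableSet_setOf_isOutwardUnitNormal {D : ℕ} {K : Set (EuclideanSpace ℝ (Fin D))}
    {c n : EuclideanSpace ℝ (Fin D)} {ρ : ℝ}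
    (h : ∀ x, IsOutwardUnitNormal K x n → inner ℝ n (x - c) = ρ) :
    MeasurableSet {x | IsOutwardUnitNormal K x n} := by
  by_cases hn : ‖n‖ = 1
  swap
  · convert MeasurableSet.empty
    ext x
    simp only [mem_ofPred_eq, mem_empty_iff_false, iff_false]
    exact fun hx => hn hx.2.1
  have : {x | IsOutwardUnitNormal K x n} = {x | inner ℝ n (x - c) = ρ} ∩
      {x | ∀ᶠ y in 𝓝 x, (y ∈ K ↔ inner ℝ n (y - c) ≤ ρ)} := by
    have hsub : ∀ x y : EuclideanSpace ℝ (Fin D), inner ℝ n (x - c) = ρ →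
        (inner ℝ n (y - x) ≤ 0 ↔ inner ℝ n (y - c) ≤ ρ) := fun x y hx => by
      rw [← sub_sub_sub_cancel_right y x c, inner_sub_right, hx, sub_nonpos]
    ext x
    constructor
    · intro hx
      have hxρ := h x hx
      refine ⟨hxρ, ?_⟩
      filter_upwards [(isOutwardUnitNormal_iff.1 hx).2] with y hy
      rw [hy, hsub x y hxρ]
    · rintro ⟨hxρ, hx⟩
      refine isOutwardUnitNormal_iff.2 ⟨hn, ?_⟩
      filter_upwards [hx] with y hy
      rw [hy, hsub x y hxρ]
  rw [this]
  exact (isClosed_eq (by fun_prop) continuous_const).measurableSet.inter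
    isOpen_setOfPred_eventually_nhds.measurableSet

/-- The boundary of a polytope is covered by finitely many hyperplanes. -/
theorem IsSolidPolytope.exists_frontier_subset {D : ℕ} {K : Set (EuclideanSpace ℝ (Fin D))}
    (hK : IsSolidPolytope K) : ∃ S : Set (EuclideanSpace ℝ (Fin D) × ℝ), S.Finite ∧
      (∀ h ∈ S, ‖h.1‖ = 1) ∧ ∀ x ∈ frontier K, ∃ h ∈ S, inner ℝ h.1 x = h.2 := by
  obtain ⟨F, hF, hP, hKF⟩ := hK.polyhedral
  choose! T hT using hP
  refine ⟨⋃ P ∈ F, (fun h => (‖h.1‖⁻¹ • h.1, ‖h.1‖⁻¹ * h.2)) '' {h | h ∈ T P ∧ h.1 ≠ 0},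
    hF.biUnion fun P _ => ((T P).finite_toSet.subset fun h hh => hh.1).image _, ?_, ?_⟩
  · simp only [mem_iUnion]
    rintro _ ⟨P, hPF, h, hh, rfl⟩
    exact norm_smul_inv_norm hh.2
  · intro x hx
    have hxK : x ∈ K := hK.isCompact.isClosed.frontier_subset hx
    have hxK' := hxK
    rw [hKF] at hxK'
    obtain ⟨P, hPF, hxP⟩ := hxK'
    have hxP' := hxP
    rw [hT P hPF] at hxP'
    by_contra! hcon
    -- If x lies on none of the hyperplanes, all nontrivial constraints of P are strict at x, so P
    -- is a neighbourhood of x.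
    refine hx.2 (mem_interior_iff_mem_nhds.2 (mem_of_superset ?_ (hKF ▸ subset_sUnion_of_mem hPF)))
    rw [hT P hPF]
    change ∀ᶠ y in 𝓝 x, ∀ h ∈ T P, inner ℝ h.1 y ≤ h.2
    rw [Filter.eventually_all_finset]
    intro h hh
    by_cases h0 : h.1 = 0
    · have := hxP' h hh
      simpa [h0] using this
    · have hlt : inner ℝ h.1 x < h.2 := by
        refine lt_of_le_of_ne (hxP' h hh) fun heq => ?_
        refine hcon _ (mem_biUnion hPF ⟨h, ⟨hh, h0⟩, rfl⟩) ?_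
        simp only [inner_smul_left, heq]
        simp
      have hc : ContinuousAt (fun y => inner ℝ h.1 y) x := Continuous.continuousAt (by fun_prop)
      filter_upwards [hc.eventually_lt continuousAt_const hlt] with y hy using hy.le

theorem IsPreconnected.subset_or_subset_compl_of_disjoint_frontier {X : Type*} [TopologicalSpace X]
    {A K : Set X} (hA : IsPreconnected A) (h : ∀ x ∈ A, x ∉ frontier K) : A ⊆ K ∨ A ⊆ Kᶜ := by
  have h2 : A ⊆ interior K ∪ interior Kᶜ := fun x hx => by
    rw [← compl_frontier_eq_union_interior]; exact h x hx
  have hd : Disjoint (interior K) (interior Kᶜ) :=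
    disjoint_compl_right.mono interior_subset interior_subset
  rcases hA.subset_or_subset isOpen_interior isOpen_interior hd h2 with h | h
  · exact Or.inl (h.trans interior_subset)
  · exact Or.inr (h.trans interior_subset)

/-- Where the boundary is contained in a hyperplane, that hyperplane carries a normal. -/
theorem isOutwardUnitNormal_or_neg {D : ℕ} {K : Set (EuclideanSpace ℝ (Fin D))}
    (hKc : IsClosed K) (hKi : closure (interior K) = K) {x n : EuclideanSpace ℝ (Fin D)}
    (hn : ‖n‖ = 1) (hx : x ∈ frontier K)
    (h : ∀ᶠ y in 𝓝 x, y ∈ frontier K → inner ℝ n (y - x) = 0) :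
    IsOutwardUnitNormal K x n ∨ IsOutwardUnitNormal K x (-n) := by
  obtain ⟨ε, hε, hb⟩ := Metric.eventually_nhds_iff_ball.1 h
  have hnn : inner ℝ n n = 1 := by rw [real_inner_self_eq_norm_sq, hn, one_pow]
  set B := Metric.ball x ε
  have hBo : IsOpen B := Metric.isOpen_ball
  have hlin : IsLinearMap ℝ (fun y : EuclideanSpace ℝ (Fin D) => inner ℝ n y) :=
    ⟨fun _ _ => inner_add_right _ _ _, fun _ _ => by rw [inner_smul_right]; rfl⟩
  have hpos : B ∩ {y | inner ℝ n x < inner ℝ n y} ⊆ K ∨ B ∩ {y | inner ℝ n x < inner ℝ n y} ⊆ Kᶜ := by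
    refine IsPreconnected.subset_or_subset_compl_of_disjoint_frontier
      ((convex_ball x ε).inter (convex_halfSpace_gt hlin _)).isPreconnected fun y hy hyK => ?_
    have := hb y hy.1 hyK
    rw [inner_sub_right, sub_eq_zero] at this
    exact hy.2.ne' this
  have hneg : B ∩ {y | inner ℝ n y < inner ℝ n x} ⊆ K ∨ B ∩ {y | inner ℝ n y < inner ℝ n x} ⊆ Kᶜ := by
    refine IsPreconnected.subset_or_subset_compl_of_disjoint_frontier
      ((convex_ball x ε).inter (convex_halfSpace_lt hlin _)).isPreconnected fun y hy hyK => ?_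
    have := hb y hy.1 hyK
    rw [inner_sub_right, sub_eq_zero] at this
    exact hy.2.ne this
  -- Points of the dividing hyperplane are limits of points on either side, so they belong to the
  -- closed set K as soon as one side does.
  have cl : ∀ (σ : ℝ) (A : Set (EuclideanSpace ℝ (Fin D))) (y : EuclideanSpace ℝ (Fin D)), A ⊆ K →
      y ∈ B → (∀ t > 0, y + (t * σ) • n ∈ B → y + (t * σ) • n ∈ A) → y ∈ K := by
    intro σ A y hA hy hyA
    by_contra hyK
    have he : ∀ᶠ z in 𝓝 y, z ∈ Kᶜ ∩ B := (hKc.isOpen_compl.inter hBo).mem_nhds ⟨hyK, hy⟩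
    obtain ⟨t, ht, ht0⟩ := ((eventually_add_smul_nhdsGT he (σ • n)).and self_mem_nhdsWithin).exists
    rw [smul_smul] at ht
    exact ht.1 (hA (hyA t ht0 ht.2))
  have incr : ∀ (y : EuclideanSpace ℝ (Fin D)) (r : ℝ), inner ℝ n (y + r • n) = inner ℝ n y + r :=
    fun y r => by rw [inner_add_right, inner_smul_right, hnn, mul_one]
  have hpos' : ∀ y ∈ B, B ∩ {y | inner ℝ n x < inner ℝ n y} ⊆ K → inner ℝ n y = inner ℝ n x → y ∈ K := by
    intro y hy hA hyx
    refine cl 1 _ y hA hy fun t ht hmem => ⟨hmem, ?_⟩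
    rw [mem_ofPred_eq, incr, hyx]; linarith
  have hneg' : ∀ y ∈ B, B ∩ {y | inner ℝ n y < inner ℝ n x} ⊆ K → inner ℝ n y = inner ℝ n x → y ∈ K := by
    intro y hy hA hyx
    refine cl (-1) _ y hA hy fun t ht hmem => ⟨hmem, ?_⟩
    rw [mem_ofPred_eq, incr, hyx]; linarith
  rcases hpos with hp | hp <;> rcases hneg with hm | hm
  · refine absurd (mem_interior_iff_mem_nhds.2 (mem_of_superset (hBo.mem_nhds (Metric.mem_ball_self hε))
      fun y hy => ?_)) hx.2
    rcases lt_trichotomy (inner ℝ n y) (inner ℝ n x) with h | h | h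
    · exact hm ⟨hy, h⟩
    · exact hpos' y hy hp h
    · exact hp ⟨hy, h⟩
  · right
    refine ⟨hx, by simpa using hn, ε, hε, fun y hy => ?_⟩
    rw [inner_neg_left, inner_sub_right, neg_nonpos, sub_nonneg]
    refine ⟨fun hyK => ?_, fun hle => ?_⟩
    · by_contra! hlt
      exact hm ⟨hy, hlt⟩ hyK
    · rcases hle.eq_or_lt with h | h
      · exact hpos' y hy hp h.symm
      · exact hp ⟨hy, h⟩
  · left
    refine ⟨hx, hn, ε, hε, fun y hy => ?_⟩
    rw [inner_sub_right, sub_nonpos]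
    refine ⟨fun hyK => ?_, fun hle => ?_⟩
    · by_contra! hlt
      exact hp ⟨hy, hlt⟩ hyK
    · rcases hle.eq_or_lt with h | h
      · exact hneg' y hy hm h
      · exact hm ⟨hy, h⟩
  -- If both sides miss K, then near x the interior of K lies in a hyperplane; being open it is
  -- empty there, contrary to K being the closure of its interior.
  · exfalso
    have hxK : x ∈ closure (interior K) := hKi.symm ▸ hKc.frontier_subset hx
    obtain ⟨y, hyB, hyi⟩ := mem_closure_iff.1 hxK B hBo (Metric.mem_ball_self hε)
    have key : ∀ z ∈ B, z ∈ interior K → inner ℝ n z = inner ℝ n x := by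
      intro z hz hzi
      rcases lt_trichotomy (inner ℝ n z) (inner ℝ n x) with h | h | h
      · exact absurd (interior_subset hzi) (hm ⟨hz, h⟩)
      · exact h
      · exact absurd (interior_subset hzi) (hp ⟨hz, h⟩)
    have he : ∀ᶠ z in 𝓝 y, z ∈ B ∩ interior K := (hBo.inter isOpen_interior).mem_nhds ⟨hyB, hyi⟩
    obtain ⟨t, ht, ht0⟩ := ((eventually_add_smul_nhdsGT he n).and self_mem_nhdsWithin).exists
    have h1 := key _ ht.1 ht.2
    rw [incr, key y hyB hyi] at h1
    have : 0 < t := ht0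
    linarith

end

/-! ### Cones over the boundary and polar coordinates in a star-regular polytope -/

section

open Topology Filter Set
open scoped ENNReal

/-- The union of the half-open segments from `c` (excluded) to the points of `F`. -/
def openCone {E : Type*} [AddCommGroup E] [Module ℝ E] (c : E) (F : Set E) : Set E :=
  {y | ∃ t ∈ Ioc (0 : ℝ) 1, ∃ x ∈ F, y = c + t • (x - c)}

theorem volume_hyperplane_eq_zero {D : ℕ} {v : EuclideanSpace ℝ (Fin D)} (hv : v ≠ 0)
    (c : EuclideanSpace ℝ (Fin D)) : volume {y | inner ℝ v (y - c) = 0} = 0 := by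
  have : {y : EuclideanSpace ℝ (Fin D) | inner ℝ v (y - c) = 0} =
      (AffineSubspace.mk' c (ℝ ∙ v)ᗮ : AffineSubspace ℝ (EuclideanSpace ℝ (Fin D))) := by
    ext y
    simp [AffineSubspace.mem_mk', Submodule.mem_orthogonal_singleton_iff_inner_right]
  rw [this]
  refine Measure.addHaar_affineSubspace _ _ fun htop => hv ?_
  have : c + v ∈ AffineSubspace.mk' c (ℝ ∙ v)ᗮ := by rw [htop]; trivial
  simpa [AffineSubspace.mem_mk', Submodule.mem_orthogonal_singleton_iff_inner_right] using this

/-- With σ and σ' the levels relative to c, eliminating the scale t puts the cone in the hyperplane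
through c orthogonal to σ' n - σ n'. If σ = 0, the first hyperplane itself contains the cone. -/
theorem volume_openCone_hyperplane_inter_eq_zero {D : ℕ} {n n' : EuclideanSpace ℝ (Fin D)}
    {s s' : ℝ} (hn : n ≠ 0) (h : ¬ {x | inner ℝ n x = s} ⊆ {x | inner ℝ n' x = s'})
    (c : EuclideanSpace ℝ (Fin D)) :
    volume (openCone c ({x | inner ℝ n x = s} ∩ {x | inner ℝ n' x = s'})) = 0 := by
  set σ := s - inner ℝ n c with hσ
  set σ' := s' - inner ℝ n' c with hσ'
  by_cases h0 : σ = 0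
  · refine measure_mono_null ?_ (volume_hyperplane_eq_zero hn c)
    rintro _ ⟨t, -, x, ⟨hx, -⟩, rfl⟩
    rw [mem_ofPred_eq] at hx ⊢
    rw [add_sub_cancel_left, inner_smul_right, inner_sub_right, hx, ← hσ, h0, mul_zero]
  have hv : σ' • n - σ • n' ≠ 0 := by
    intro hv
    refine h fun x hx => ?_
    have h1 : σ * inner ℝ n' (x - c) = σ' * inner ℝ n (x - c) := by
      have := congrArg (fun w => inner ℝ w (x - c)) hv
      simp only [inner_sub_left, inner_smul_left, inner_zero_left] at this
      simp at this
      linarith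
    rw [mem_ofPred_eq] at hx ⊢
    rw [inner_sub_right n, hx, ← hσ, mul_comm σ'] at h1
    have h2 := mul_left_cancel₀ h0 h1
    rw [inner_sub_right, hσ'] at h2
    linarith
  refine measure_mono_null ?_ (volume_hyperplane_eq_zero hv c)
  rintro _ ⟨t, -, x, ⟨hx, hx'⟩, rfl⟩
  rw [mem_ofPred_eq] at hx hx' ⊢
  rw [add_sub_cancel_left, inner_smul_right, inner_sub_left, inner_smul_left, inner_smul_left,
    inner_sub_right, inner_sub_right, hx, hx', ← hσ, ← hσ']
  simp; right; ring

theorem openCone_biUnion {E ι : Type*} [AddCommGroup E] [Module ℝ E] (c : E) (I : Set ι)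
    (F : ι → Set E) : openCone c (⋃ i ∈ I, F i) = ⋃ i ∈ I, openCone c (F i) := by
  ext y
  simp only [openCone, mem_iUnion, mem_ofPred_eq]
  constructor
  · rintro ⟨t, ht, x, ⟨i, hi, hx⟩, rfl⟩
    exact ⟨i, hi, t, ht, x, hx, rfl⟩
  · rintro ⟨i, hi, t, ht, x, hx, rfl⟩
    exact ⟨t, ht, x, ⟨i, hi, hx⟩, rfl⟩

/-- Up to a set that is negligible and spans a negligible cone, the boundary of a polytope
consists of points with an outward normal, and finitely many normals occur. -/
theorem IsSolidPolytope.exists_frontier_eq {d : ℕ} {K : Set (EuclideanSpace ℝ (Fin (d + 1)))}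
    (hK : IsSolidPolytope K) (c : EuclideanSpace ℝ (Fin (d + 1))) :
    ∃ (N : Finset (EuclideanSpace ℝ (Fin (d + 1)))) (B : Set (EuclideanSpace ℝ (Fin (d + 1)))),
      frontier K ⊆ (⋃ n ∈ (N : Set _), {x | IsOutwardUnitNormal K x n}) ∪ B ∧
      Measure.hausdorffMeasure (d : ℝ) B = 0 ∧ volume (openCone c B) = 0 := by
  classical
  obtain ⟨S, hS, hS1, hSK⟩ := hK.exists_frontier_subset
  set H : EuclideanSpace ℝ (Fin (d + 1)) × ℝ → Set (EuclideanSpace ℝ (Fin (d + 1))) :=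
    fun h => {x | inner ℝ h.1 x = h.2} with hH
  -- The exceptional set consists of the intersections of distinct hyperplanes; elsewhere all
  -- hyperplanes through a boundary point coincide.
  set I := {p | p ∈ S ×ˢ S ∧ ¬ H p.1 ⊆ H p.2} with hI
  have hIf : I.Finite := (hS.prod hS).subset fun p hp => hp.1
  refine ⟨(hS.image Prod.fst).toFinset ∪ (hS.image fun h => -h.1).toFinset,
    ⋃ p ∈ I, H p.1 ∩ H p.2, fun x hx => ?_, ?_, ?_⟩
  · obtain ⟨h, hh, hxh⟩ := hSK x hx
    by_cases hB : x ∈ ⋃ p ∈ I, H p.1 ∩ H p.2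
    · exact Or.inr hB
    left
    have hsub : ∀ h' ∈ S, x ∈ H h' → H h' ⊆ H h := by
      intro h' hh' hxh'
      by_contra hcon
      exact hB (mem_biUnion (x := (h', h)) ⟨⟨hh', hh⟩, hcon⟩ ⟨hxh', hxh⟩)
    have hev : ∀ᶠ y in 𝓝 x, ∀ h' ∈ S, x ∉ H h' → y ∉ H h' := by
      rw [Filter.eventually_all_finite hS]
      intro h' _
      by_cases hxh' : x ∈ H h'
      · exact Eventually.of_forall fun y hc => absurd hxh' hc
      · have hcl : IsClosed (H h') := isClosed_eq (by fun_prop) continuous_const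
        filter_upwards [hcl.isOpen_compl.mem_nhds hxh'] with y hy _ using hy
    have hev' : ∀ᶠ y in 𝓝 x, y ∈ frontier K → inner ℝ h.1 (y - x) = 0 := by
      filter_upwards [hev] with y hy hyK
      obtain ⟨h', hh', hyh'⟩ := hSK y hyK
      have hyh : inner ℝ h.1 y = h.2 :=
        hsub h' hh' (by by_contra hc; exact hy h' hh' hc hyh') hyh'
      rw [inner_sub_right, hyh, hxh, sub_self]
    rcases isOutwardUnitNormal_or_neg hK.isCompact.isClosed hK.closure_interior (hS1 h hh) hx hev'
      with hnor | hnor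
    · exact mem_biUnion (x := h.1) (by simp only [Finset.coe_union, Finite.coe_toFinset]; exact Or.inl ⟨h, hh, rfl⟩) hnor
    · exact mem_biUnion (x := -h.1) (by simp only [Finset.coe_union, Finite.coe_toFinset]; exact Or.inr ⟨h, hh, rfl⟩) hnor
  · rw [measure_biUnion_null_iff hIf.countable]
    exact fun p hp => hausdorffMeasure_hyperplane_inter_eq_zero (hS1 _ hp.1.1) hp.2
  · rw [openCone_biUnion, measure_biUnion_null_iff hIf.countable]
    refine fun p hp => volume_openCone_hyperplane_inter_eq_zero ?_ hp.2 c
    rw [← norm_ne_zero_iff, hS1 _ hp.1.1]; exact one_ne_zero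

theorem openCone_subset {E : Type*} [AddCommGroup E] [Module ℝ E] {c : E} {F K : Set E}
    (hK : StarConvex ℝ c K) (h : F ⊆ K) : openCone c F ⊆ K := by
  rintro _ ⟨t, ht, x, hx, rfl⟩
  exact hK.add_smul_sub_mem (h hx) ht.1.le ht.2

/-- By compactness the ray from c through y has a last point in K, which is a boundary point. -/
theorem subset_insert_openCone_frontier {E : Type*} [NormedAddCommGroup E] [NormedSpace ℝ E]
    {K : Set E} (hK : IsCompact K) (c : E) : K ⊆ insert c (openCone c (frontier K)) := by
  intro y hy
  rcases eq_or_ne y c with rfl | hyc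
  · exact mem_insert _ _
  right
  set f : ℝ → E := fun l => c + l • (y - c) with hf
  have hfc : Continuous f := by fun_prop
  have hyc' : y - c ≠ 0 := sub_ne_zero.2 hyc
  have hcomp : IsCompact (Ici 1 ∩ f ⁻¹' K) := by
    rw [Metric.isCompact_iff_isClosed_bounded]
    refine ⟨isClosed_Ici.inter (hK.isClosed.preimage hfc), ?_⟩
    obtain ⟨R, hR⟩ := hK.isBounded.subset_ball c
    refine (Metric.isBounded_Icc (0 : ℝ) (R / ‖y - c‖)).subset fun l hl => ⟨?_, ?_⟩
    · linarith [show (1 : ℝ) ≤ l from hl.1]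
    · have h1 := hR hl.2
      have hl0 : (0 : ℝ) ≤ l := by linarith [show (1 : ℝ) ≤ l from hl.1]
      rw [Metric.mem_ball, dist_eq_norm, hf, add_sub_cancel_left, norm_smul, Real.norm_eq_abs,
        abs_of_nonneg hl0] at h1
      rw [le_div_iff₀ (norm_pos_iff.2 hyc')]
      exact h1.le
  obtain ⟨l, ⟨hl1, hlK⟩, hmax⟩ := hcomp.exists_isMaxOn ⟨1, self_mem_Ici, by simpa [hf] using hy⟩
    continuousOn_id
  have hl1 : 1 ≤ l := hl1
  have hl0 : 0 < l := by linarith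
  refine ⟨l⁻¹, ⟨inv_pos.2 hl0, inv_le_one_of_one_le₀ hl1⟩, f l,
    ⟨subset_closure hlK, fun hint => ?_⟩, ?_⟩
  · obtain ⟨t, ht, ht0⟩ := ((eventually_add_smul_nhdsGT (mem_interior_iff_mem_nhds.1 hint) (y - c)).and
      self_mem_nhdsWithin).exists
    have ht0 : 0 < t := ht0
    have h2 : l + t ≤ l := hmax ⟨by rw [mem_Ici]; linarith, by
      rw [mem_preimage, hf]; simp only [add_smul, ← add_assoc]; exact ht⟩
    linarith
  · simp [hf, smul_smul, inv_mul_cancel₀ hl0.ne']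

/-- A point of K beyond x on its ray would, by star-convexity, put points just beyond x into K, on
the outer side of the face. -/
theorem IsOutwardUnitNormal.le_one_of_starConvex {D : ℕ} {K : Set (EuclideanSpace ℝ (Fin D))}
    {c x x' n : EuclideanSpace ℝ (Fin D)} (hK : StarConvex ℝ c K) (h : IsOutwardUnitNormal K x n)
    (hpos : 0 < inner ℝ n (x - c)) (hx' : x' ∈ K) {l : ℝ} (hl : x' - c = l • (x - c)) : l ≤ 1 := by
  by_contra! hl1
  obtain ⟨t, ht, ht0⟩ := ((eventually_add_smul_nhdsGT (isOutwardUnitNormal_iff.1 h).2 (x - c)).and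
    (Ioo_mem_nhdsGT (sub_pos.2 hl1))).exists
  rw [add_sub_cancel_left, inner_smul_right] at ht
  have hl0 : 0 < l := by linarith
  have hmem : x + t • (x - c) ∈ K := by
    have := hK.add_smul_sub_mem hx' (t := (1 + t) / l) (div_nonneg (by linarith [ht0.1]) hl0.le)
      ((div_le_one hl0).2 (by linarith [ht0.2]))
    rw [hl, smul_smul, div_mul_cancel₀ _ hl0.ne', add_smul, one_smul] at this
    convert this using 1
    abel
  have := ht.1 hmem
  nlinarith [mul_pos ht0.1 hpos]

/-- Two points with normals on one ray each bound the other, so they coincide, and the normal at a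
point is unique. -/
theorem disjoint_openCone_normal {D : ℕ} {K : Set (EuclideanSpace ℝ (Fin D))}
    {c n n' : EuclideanSpace ℝ (Fin D)} (hKc : IsClosed K) (hK : StarConvex ℝ c K)
    (hpos : ∀ x n, IsOutwardUnitNormal K x n → 0 < inner ℝ n (x - c)) (hnn : n ≠ n') :
    Disjoint (openCone c {x | IsOutwardUnitNormal K x n})
      (openCone c {x | IsOutwardUnitNormal K x n'}) := by
  rw [Set.disjoint_left]
  rintro _ ⟨t, ht, x, hx, rfl⟩ ⟨t', ht', x', hx', heq⟩
  have heq : t • (x - c) = t' • (x' - c) := add_left_cancel heq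
  have h1 : x' - c = (t'⁻¹ * t) • (x - c) := by
    rw [mul_smul, heq, smul_smul, inv_mul_cancel₀ ht'.1.ne', one_smul]
  have h2 : x - c = (t⁻¹ * t') • (x' - c) := by
    rw [mul_smul, ← heq, smul_smul, inv_mul_cancel₀ ht.1.ne', one_smul]
  have l1 := IsOutwardUnitNormal.le_one_of_starConvex hK hx (hpos _ _ hx)
    (hKc.frontier_subset hx'.1) h1
  have l2 := IsOutwardUnitNormal.le_one_of_starConvex hK hx' (hpos _ _ hx')
    (hKc.frontier_subset hx.1) h2
  rw [inv_mul_le_iff₀ ht'.1, mul_one] at l1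
  rw [inv_mul_le_iff₀ ht.1, mul_one] at l2
  have htt : t = t' := le_antisymm l1 l2
  subst htt
  have hxx : x = x' := sub_left_injective (smul_right_injective _ ht.1.ne' heq)
  subst hxx
  exact hnn (IsOutwardUnitNormal.eq hx hx')

/-- The cone is the part at levels in (0, ρ] of the preimage of F under radial projection onto the
hyperplane, a measurable map. -/
theorem measurableSet_openCone {D : ℕ} {c n : EuclideanSpace ℝ (Fin D)} {ρ : ℝ} (hρ : 0 < ρ)
    {F : Set (EuclideanSpace ℝ (Fin D))} (hF : MeasurableSet F)
    (hFn : ∀ x ∈ F, inner ℝ n (x - c) = ρ) : MeasurableSet (openCone c F) := by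
  have : openCone c F = {y | inner ℝ n (y - c) ∈ Ioc 0 ρ} ∩
      (fun y => c + (ρ / inner ℝ n (y - c)) • (y - c)) ⁻¹' F := by
    ext y
    constructor
    · rintro ⟨t, ht, x, hx, rfl⟩
      have h1 : inner ℝ n (c + t • (x - c) - c) = t * ρ := by
        rw [add_sub_cancel_left, inner_smul_right, hFn x hx]
      refine ⟨?_, ?_⟩
      · rw [mem_ofPred_eq, h1]
        exact ⟨mul_pos ht.1 hρ, by nlinarith [ht.2]⟩
      · rw [mem_preimage, h1, add_sub_cancel_left, smul_smul]
        have : ρ / (t * ρ) * t = 1 := by have := ht.1.ne'; field_simp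
        rw [this, one_smul, add_sub_cancel]
        exact hx
    · rintro ⟨h1, h2⟩
      have h1 : inner ℝ n (y - c) ∈ Ioc 0 ρ := h1
      refine ⟨inner ℝ n (y - c) / ρ, ⟨div_pos h1.1 hρ, (div_le_one hρ).2 h1.2⟩, _, h2, ?_⟩
      have : inner ℝ n (y - c) / ρ * (ρ / inner ℝ n (y - c)) = 1 := by
        have := h1.1.ne'; field_simp
      rw [add_sub_cancel_left, smul_smul, this, one_smul, add_sub_cancel]
  rw [this]
  have hm : Measurable fun y : EuclideanSpace ℝ (Fin D) => inner ℝ n (y - c) :=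
    Continuous.measurable (by fun_prop)
  have hm' : Measurable fun y : EuclideanSpace ℝ (Fin D) => c + (ρ / inner ℝ n (y - c)) • (y - c) :=
    ((measurable_const.div hm).smul (measurable_id.sub_const c)).const_add c
  exact (hm measurableSet_Ioc).inter (hm' hF)

/-- The half-space formula applied to G cut off by the cone: on the ray through x the cutoff selects
t ≤ 1 and x ∈ F. The constant a depends on d only. -/
theorem exists_lintegral_openCone_const (d : ℕ) : ∃ a : ℝ≥0∞, a ≠ 0 ∧ a ≠ ∞ ∧
    ∀ (c n : EuclideanSpace ℝ (Fin (d + 1))) (ρ : ℝ), ‖n‖ = 1 → 0 < ρ →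
    ∀ F : Set (EuclideanSpace ℝ (Fin (d + 1))), MeasurableSet F →
    (∀ x ∈ F, inner ℝ n (x - c) = ρ) →
    ∀ G : EuclideanSpace ℝ (Fin (d + 1)) → ℝ≥0∞, Measurable G →
    ∫⁻ y in openCone c F, G y = ENNReal.ofReal ρ * a * ∫⁻ x in F,
        (∫⁻ t in Ioc (0 : ℝ) 1, ENNReal.ofReal (t ^ d) * G (c + t • (x - c)))
          ∂(Measure.hausdorffMeasure (d : ℝ)) := by
  obtain ⟨a, ha0, ha, h⟩ := exists_lintegral_halfspace_const d
  refine ⟨a, ha0, ha, fun c n ρ hn hρ F hF hFn G hG => ?_⟩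
  have hcone := measurableSet_openCone hρ hF hFn
  have h1 := h c n ρ hn hρ _ (hG.indicator hcone)
  have hsub : openCone c F ⊆ {y | 0 < inner ℝ n (y - c)} := by
    rintro _ ⟨t, ht, x, hx, rfl⟩
    rw [mem_ofPred_eq, add_sub_cancel_left, inner_smul_right, hFn x hx]
    exact mul_pos ht.1 hρ
  rw [setLIntegral_indicator hcone, inter_eq_left.2 hsub] at h1
  rw [h1]
  congr 1
  have hH : MeasurableSet {x : EuclideanSpace ℝ (Fin (d + 1)) | inner ℝ n (x - c) = ρ} :=
    (isClosed_eq (by fun_prop) continuous_const).measurableSet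
  rw [← inter_eq_left.2 (show F ⊆ {x | inner ℝ n (x - c) = ρ} from hFn), ← setLIntegral_indicator hF,
    inter_eq_left.2 (show F ⊆ {x | inner ℝ n (x - c) = ρ} from hFn)]
  refine setLIntegral_congr_fun hH fun x hx => ?_
  have hx : inner ℝ n (x - c) = ρ := hx
  have hmem : ∀ t : ℝ, 0 < t → (c + t • (x - c) ∈ openCone c F ↔ t ∈ Iic 1 ∧ x ∈ F) := by
    intro t ht
    constructor
    · rintro ⟨t', ht', x', hx', heq⟩
      have heq : t • (x - c) = t' • (x' - c) := add_left_cancel heq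
      have h2 := congrArg (fun w => inner ℝ n w) heq
      simp only [inner_smul_right, hx, hFn x' hx'] at h2
      have htt : t = t' := mul_right_cancel₀ hρ.ne' h2
      subst htt
      have hxx : x = x' := sub_left_injective (smul_right_injective _ ht.ne' heq)
      exact ⟨ht'.2, hxx ▸ hx'⟩
    · rintro ⟨ht1, hxF⟩
      exact ⟨t, ⟨ht, ht1⟩, x, hxF, rfl⟩
  by_cases hxF : x ∈ F
  · rw [indicator_of_mem hxF, ← Ioi_inter_Iic, inter_comm, ← setLIntegral_indicator measurableSet_Iic]
    refine setLIntegral_congr_fun measurableSet_Ioi fun t ht => ?_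
    simp only [indicator, hmem t ht, hxF, and_true, mul_ite, mul_zero]
  · rw [indicator_of_notMem hxF]
    refine (setLIntegral_congr_fun measurableSet_Ioi fun t ht => ?_).trans lintegral_zero
    simp only [indicator, hmem t ht, hxF, and_false, if_false, mul_zero]

/-- Polar coordinates in a star-regular polytope. -/
theorem exists_lintegral_eq_of_isStarRegularPolytope {d : ℕ}
    {K : Set (EuclideanSpace ℝ (Fin (d + 1)))} (hK : IsStarRegularPolytope K) :
    ∃ (c : EuclideanSpace ℝ (Fin (d + 1))) (κ : ℝ≥0∞), StarConvex ℝ c K ∧ κ ≠ 0 ∧ κ ≠ ∞ ∧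
      ∀ G : EuclideanSpace ℝ (Fin (d + 1)) → ℝ≥0∞, Measurable G →
      ∫⁻ y in K, G y = κ * ∫⁻ x in frontier K,
        (∫⁻ t in Ioc (0 : ℝ) 1, ENNReal.ofReal (t ^ d) * G (c + t • (x - c)))
          ∂(Measure.hausdorffMeasure (d : ℝ)) := by
  obtain ⟨hP, c, hstar, ρ, hρ, hnor⟩ := hK
  obtain ⟨a, ha0, ha, hcone⟩ := exists_lintegral_openCone_const d
  obtain ⟨N, B, hNB, hB, hBc⟩ := hP.exists_frontier_eq c
  -- Star-regularity enters here: ρ is common to all faces, so a single factor serves the whole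
  -- boundary.
  refine ⟨c, ENNReal.ofReal ρ * a, hstar, mul_ne_zero (by simpa using hρ) ha0,
    ENNReal.mul_ne_top ENNReal.ofReal_ne_top ha, fun G hG => ?_⟩
  set F : EuclideanSpace ℝ (Fin (d + 1)) → Set (EuclideanSpace ℝ (Fin (d + 1))) :=
    fun n => {x | IsOutwardUnitNormal K x n} with hF
  have hFm : ∀ n, MeasurableSet (F n) := fun n => measurableSet_setOf_isOutwardUnitNormal
    fun x hx => hnor x n hx
  have hFfr : ⋃ n ∈ (N : Set _), F n ⊆ frontier K := iUnion₂_subset fun n _ x hx => hx.1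
  have hfr : (⋃ n ∈ N, F n : Set _) =ᵐ[Measure.hausdorffMeasure (d : ℝ)] frontier K := by
    refine (LE.le.eventuallyLE hFfr).antisymm (ae_le_set.2 (measure_mono_null ?_ hB))
    exact sdiff_subset_iff.2 hNB
  have hKae : (⋃ n ∈ N, openCone c (F n) : Set _) =ᵐ[volume] K := by
    refine (LE.le.eventuallyLE (iUnion₂_subset fun n _ => openCone_subset hstar
      fun x hx => hP.isCompact.isClosed.frontier_subset hx.1)).antisymm
      (ae_le_set.2 (measure_mono_null ?_ (measure_union_null (measure_singleton c) hBc)))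
    rw [sdiff_subset_iff]
    intro y hy
    rcases subset_insert_openCone_frontier hP.isCompact c hy with rfl | ⟨t, ht, x, hx, rfl⟩
    · exact Or.inr (Or.inl rfl)
    · rcases hNB hx with h | h
      · obtain ⟨n, hn, hxn⟩ := mem_iUnion₂.1 h
        exact Or.inl (mem_iUnion₂.2 ⟨n, hn, t, ht, x, hxn, rfl⟩)
      · exact Or.inr (Or.inr ⟨t, ht, x, h, rfl⟩)
  rw [← setLIntegral_congr hKae, ← setLIntegral_congr hfr,
    lintegral_biUnion_finset, lintegral_biUnion_finset, Finset.mul_sum]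
  · refine Finset.sum_congr rfl fun n _ => ?_
    by_cases hn : ‖n‖ = 1
    · exact hcone c n ρ hn hρ (F n) (hFm n) (fun x hx => hnor x n hx) G hG
    · have : F n = ∅ := eq_empty_of_forall_notMem fun x hx => hn hx.2.1
      simp [this, openCone]
  · intro n _ n' _ hnn
    exact Set.disjoint_left.2 fun x hx hx' => hnn (IsOutwardUnitNormal.eq hx hx')
  · exact fun n _ => hFm n
  · intro n _ n' _ hnn
    exact disjoint_openCone_normal hP.isCompact.isClosed hstar
      (fun x n hx => by rw [hnor x n hx]; exact hρ) hnn
  · exact fun n _ => measurableSet_openCone hρ (hFm n) (fun x hx => hnor x n hx)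

end

/-! ### The bound for star-regular polytopes -/

section

open Set
open scoped ENNReal

open Polynomial in
theorem exists_polynomial_polyValue_ray {D : ℕ} (U : MvPolynomial (Fin D) ℝ)
    (c v : EuclideanSpace ℝ (Fin D)) : ∃ p : ℝ[X], p.natDegree ≤ U.totalDegree ∧
      ∀ t : ℝ, p.eval t = polyValue U (c + t • v) := by
  refine ⟨MvPolynomial.eval₂ (C : ℝ →+* ℝ[X]) (fun i => C (c i) + X * C (v i)) U, ?_, fun t => ?_⟩
  · rw [MvPolynomial.eval₂_eq]
    refine natDegree_sum_le_of_forall_le _ _ fun m hm => (natDegree_C_mul_le _ _).trans ?_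
    refine (natDegree_prod_le _ _).trans (le_trans (Finset.sum_le_sum fun i _ => ?_)
      (MvPolynomial.le_totalDegree hm))
    refine natDegree_pow_le.trans ((Nat.mul_le_mul_left _ ?_).trans (mul_one _).le)
    refine natDegree_add_le_of_degree_le (by simp) ?_
    exact (natDegree_mul_C_le _ _).trans natDegree_X_le
  · rw [polyValue, ← Polynomial.coe_evalRingHom, MvPolynomial.hom_eval₂]
    have : (Polynomial.evalRingHom t).comp (C : ℝ →+* ℝ[X]) = RingHom.id ℝ := by ext; simp
    rw [this, MvPolynomial.eval₂_id]
    congr 2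
    funext i
    simp
    exact mul_comm _ _

theorem continuous_polyValue {D : ℕ} (U : MvPolynomial (Fin D) ℝ) : Continuous (polyValue U) :=
  (MvPolynomial.continuous_eval U).comp (by fun_prop)

theorem lintegral_ray_polyValue_ge {d k : ℕ} {K : Set (EuclideanSpace ℝ (Fin (d + 1)))}
    {c x : EuclideanSpace ℝ (Fin (d + 1))} (hK : StarConvex ℝ c K) (hx : x ∈ K)
    {U : MvPolynomial (Fin (d + 1)) ℝ} (hUk : U.totalDegree ≤ k)
    (hU : ∀ x ∈ K, 0 ≤ polyValue U x) :
    ENNReal.ofReal (polyValue U x) ≤ ENNReal.ofReal (((d + 1 : ℕ) : ℝ) * starWeight (d + 1) k) *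
      ∫⁻ t in Ioc (0 : ℝ) 1,
        ENNReal.ofReal (t ^ d) * ENNReal.ofReal (polyValue U (c + t • (x - c))) := by
  obtain ⟨p, hpd, hp⟩ := exists_polynomial_polyValue_ray U c (x - c)
  have hpn : ∀ t ∈ Icc (0 : ℝ) 1, 0 ≤ p.eval t := fun t ht => by
    rw [hp]; exact hU _ (hK.add_smul_sub_mem hx ht.1 ht.2)
  have h := eval_one_le_integral_of_nonneg k d p (hpd.trans hUk) hpn
  have hW : ((d + 1 : ℕ) : ℝ) * starWeight (d + 1) k =
      (((k / 2 : ℕ) : ℝ) + 1) * ((((k + 1) / 2 : ℕ) : ℝ) + ((d + 1 : ℕ) : ℝ)) := by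
    rw [starWeight, mul_div_cancel₀]; positivity
  have hint : IntegrableOn (fun t : ℝ => t ^ d * p.eval t) (Ioc 0 1) :=
    (Continuous.integrableOn_Icc (by fun_prop)).mono_set Ioc_subset_Icc_self
  have hpx : p.eval 1 = polyValue U x := by rw [hp, one_smul, add_sub_cancel]
  rw [← hW, hpx, intervalIntegral.integral_of_le zero_le_one] at h
  have hnn : 0 ≤ᵐ[volume.restrict (Ioc (0 : ℝ) 1)] fun t : ℝ => t ^ d * p.eval t :=
    (ae_restrict_iff' measurableSet_Ioc).2 (Filter.Eventually.of_forall fun t ht =>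
      mul_nonneg (pow_nonneg ht.1.le _) (hpn t (Ioc_subset_Icc_self ht)))
  calc _ ≤ _ := ENNReal.ofReal_le_ofReal h
    _ = _ := by
      rw [ENNReal.ofReal_mul (by rw [hW]; positivity), ofReal_integral_eq_lintegral_ofReal hint hnn]
      congr 1
      refine setLIntegral_congr_fun measurableSet_Ioc fun t ht => ?_
      rw [ENNReal.ofReal_mul (pow_nonneg ht.1.le _), hp]

theorem lintegral_Ioc_pow (d : ℕ) :
    ∫⁻ t in Ioc (0 : ℝ) 1, ENNReal.ofReal (t ^ d) = ENNReal.ofReal ((d + 1 : ℕ) : ℝ)⁻¹ := by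
  have hint : IntegrableOn (fun t : ℝ => t ^ d) (Ioc 0 1) :=
    (Continuous.integrableOn_Icc (by fun_prop)).mono_set Ioc_subset_Icc_self
  have hnn : 0 ≤ᵐ[volume.restrict (Ioc (0 : ℝ) 1)] fun t : ℝ => t ^ d :=
    (ae_restrict_iff' measurableSet_Ioc).2 (Filter.Eventually.of_forall fun t ht =>
      pow_nonneg ht.1.le _)
  rw [← ofReal_integral_eq_lintegral_ofReal hint hnn, ← intervalIntegral.integral_of_le zero_le_one,
    integral_pow]
  simp

theorem average_eq_toReal_div {α : Type*} [MeasurableSpace α] (μ : Measure α) {s : Set α}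
    (hs : MeasurableSet s) {f : α → ℝ} (hf : Measurable f) (h0 : ∀ x ∈ s, 0 ≤ f x) :
    ⨍ x in s, f x ∂μ = ((∫⁻ x in s, ENNReal.ofReal (f x) ∂μ) / μ s).toReal := by
  rw [setAverage_eq, integral_eq_lintegral_of_nonneg_ae
    ((ae_restrict_iff' hs).2 (Filter.Eventually.of_forall h0)) hf.aestronglyMeasurable,
    ENNReal.toReal_div, smul_eq_mul, measureReal_def, div_eq_inv_mul]

/-- Polar coordinates for U = 1 give the ratio of volume to surface measure, and for U they reduce
the claim to the inequality on rays; κ then cancels. -/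
theorem boundaryAverage_le_starWeight_mul {d k : ℕ} {K : Set (EuclideanSpace ℝ (Fin (d + 1)))}
    (hK : IsStarRegularPolytope K) {U : MvPolynomial (Fin (d + 1)) ℝ} (hUk : U.totalDegree ≤ k)
    (hU : ∀ x ∈ K, 0 ≤ polyValue U x) :
    boundaryAverage K U ≤ starWeight (d + 1) k * cellAverage K U := by
  obtain ⟨c, κ, hstar, hκ0, hκ, hpolar⟩ := exists_lintegral_eq_of_isStarRegularPolytope hK
  have hcpt := hK.1.isCompact
  have hfrK : frontier K ⊆ K := hcpt.isClosed.frontier_subset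
  have hUm : Measurable (polyValue U) := (continuous_polyValue U).measurable
  have hcast : (((d + 1 : ℕ) : ℝ) - 1) = (d : ℝ) := by push_cast; ring
  rw [boundaryAverage, cellAverage, hcast,
    average_eq_toReal_div _ hcpt.isClosed.measurableSet hUm hU,
    average_eq_toReal_div _ isClosed_frontier.measurableSet hUm fun x hx => hU x (hfrK hx)]
  set μ : Measure (EuclideanSpace ℝ (Fin (d + 1))) := Measure.hausdorffMeasure (d : ℝ)
  set δ : ℝ := ((d + 1 : ℕ) : ℝ)
  have hδ : 0 < δ := by positivity
  have hW : 0 < starWeight (d + 1) k := by rw [starWeight]; positivity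
  set W := starWeight (d + 1) k
  have hvol : volume K = κ * (ENNReal.ofReal δ⁻¹ * μ (frontier K)) := by
    have := hpolar (fun _ => 1) measurable_const
    simpa [lintegral_Ioc_pow, mul_assoc, δ] using this
  have hbd : ∫⁻ x in frontier K, ENNReal.ofReal (polyValue U x) ∂μ ≤ ENNReal.ofReal (δ * W) *
      (κ⁻¹ * ∫⁻ x in K, ENNReal.ofReal (polyValue U x)) := by
    rw [hpolar (fun y => ENNReal.ofReal (polyValue U y)) hUm.ennreal_ofReal, ← mul_assoc κ⁻¹,
      ENNReal.inv_mul_cancel hκ0 hκ, one_mul, ← lintegral_const_mul' _ _ ENNReal.ofReal_ne_top]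
    exact setLIntegral_mono' isClosed_frontier.measurableSet fun x hx =>
      lintegral_ray_polyValue_ge hstar (hfrK hx) hUk hU
  have hfin : ∫⁻ x in K, ENNReal.ofReal (polyValue U x) ≠ ∞ :=
    ((continuous_polyValue U).continuousOn.integrableOn_compact hcpt).lintegral_lt_top.ne
  have hvfin : volume K ≠ ∞ := hcpt.measure_lt_top.ne
  have hv0 : volume K ≠ 0 := by
    have hne : (interior K).Nonempty := by
      rw [← closure_nonempty_iff, hK.1.closure_interior]; exact hK.1.nonempty
    exact ((isOpen_interior.measure_pos _ hne).trans_le (measure_mono interior_subset)).ne'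
  have hμ : μ (frontier K) = ENNReal.ofReal δ * (κ⁻¹ * volume K) := by
    rw [hvol, ← mul_assoc κ⁻¹, ENNReal.inv_mul_cancel hκ0 hκ, one_mul, ← mul_assoc,
      ← ENNReal.ofReal_mul hδ.le, mul_inv_cancel₀ hδ.ne', ENNReal.ofReal_one, one_mul]
  have hκr : 0 < κ.toReal := ENNReal.toReal_pos hκ0 hκ
  have hvr : 0 < (volume K).toReal := ENNReal.toReal_pos hv0 hvfin
  have hbd' := ENNReal.toReal_mono (ENNReal.mul_ne_top ENNReal.ofReal_ne_top
    (ENNReal.mul_ne_top (ENNReal.inv_ne_top.2 hκ0) hfin)) hbd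
  rw [ENNReal.toReal_div, ENNReal.toReal_div, hμ]
  simp only [ENNReal.toReal_mul, ENNReal.toReal_ofReal hδ.le, ENNReal.toReal_inv,
    ENNReal.toReal_ofReal (mul_pos hδ hW).le] at hbd' ⊢
  rw [div_le_iff₀ (by positivity)]
  refine hbd'.trans (le_of_eq ?_)
  field_simp

theorem optimalInteriorWeight_le_of_isStarRegularPolytope {D : ℕ} (hD : 1 ≤ D) (k : ℕ)
    {K : Set (EuclideanSpace ℝ (Fin D))} (hK : IsStarRegularPolytope K) :
    IsLUB (boundaryCrowding K '' positiveSolutions K k) (optimalInteriorWeight K k) ∧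
      optimalInteriorWeight K k ≤ starWeight D k := by
  obtain ⟨d, rfl⟩ : ∃ d, D = d + 1 := ⟨D - 1, by omega⟩
  have hub : ∀ y ∈ boundaryCrowding K '' positiveSolutions K k, y ≤ starWeight (d + 1) k := by
    rintro _ ⟨U, ⟨hUk, hU, hpos⟩, rfl⟩
    exact (div_le_iff₀ hpos).2 (boundaryAverage_le_starWeight_mul hK hUk hU)
  have hv0 : volume K ≠ 0 := by
    have hne : (interior K).Nonempty := by
      rw [← closure_nonempty_iff, hK.1.closure_interior]; exact hK.1.nonempty
    exact ((isOpen_interior.measure_pos _ hne).trans_le (measure_mono interior_subset)).ne'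
  have hne : (boundaryCrowding K '' positiveSolutions K k).Nonempty := by
    -- The constant polynomial 1 makes the set nonempty, so that `sSup` is a genuine supremum.
    refine ⟨_, 1, ⟨by simp, fun x _ => by simp [polyValue], ?_⟩, rfl⟩
    have : cellAverage K (1 : MvPolynomial (Fin (d + 1)) ℝ) = 1 := by
      simp only [cellAverage, polyValue, map_one]
      exact setAverage_const hv0 hK.1.isCompact.measure_lt_top.ne 1
    rw [this]; exact one_pos
  exact ⟨isLUB_csSup hne ⟨_, hub⟩, csSup_le hne hub⟩

end

/-! ### Regular simplices -/

section

open Topology Filter Set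

/-- Summing ‖q i - q j‖² over j removes the cross terms, since the q j sum to zero, and determines
the norms. Polarisation gives the inner products. -/
theorem inner_eq_of_sum_eq_zero_of_norm_sub {E ι : Type*} [NormedAddCommGroup E]
    [InnerProductSpace ℝ E] [Fintype ι] [DecidableEq ι] [Nonempty ι] {q : ι → E} {r : ℝ}
    (hq : ∑ i, q i = 0) (hr : ∀ i j, i ≠ j → ‖q i - q j‖ = r) (i j : ι) :
    inner ℝ (q i) (q j) = r ^ 2 / 2 * ((if i = j then 1 else 0) - 1 / (Fintype.card ι : ℝ)) := by
  set M : ℝ := (Fintype.card ι : ℝ) with hM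
  have hM0 : M ≠ 0 := by simp [hM]
  have hsq : ∀ i j, ‖q i - q j‖ ^ 2 = r ^ 2 * (1 - if i = j then 1 else 0) := by
    intro i j
    by_cases h : i = j
    · simp [h]
    · rw [hr i j h]; simp [h]
  set S := ∑ j, ‖q j‖ ^ 2 with hS
  have h1 : ∀ i, M * ‖q i‖ ^ 2 + S = r ^ 2 * (M - 1) := by
    intro i
    have h2 : ∑ j, ‖q i - q j‖ ^ 2 = M * ‖q i‖ ^ 2 + S := by
      simp only [norm_sub_sq_real, Finset.sum_add_distrib, Finset.sum_sub_distrib]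
      rw [← Finset.mul_sum, ← inner_sum, hq]
      simp [hM, hS]
    rw [← h2, Finset.sum_congr rfl fun j _ => hsq i j, ← Finset.mul_sum]
    simp [hM]
  have h3 : M * S + M * S = M * (r ^ 2 * (M - 1)) := by
    have := Finset.sum_congr (rfl : (Finset.univ : Finset ι) = Finset.univ) fun i _ => h1 i
    rw [Finset.sum_add_distrib, ← Finset.mul_sum] at this
    simpa [hM, hS] using this
  have hS2 : S = r ^ 2 * (M - 1) / 2 := by
    have := mul_left_cancel₀ hM0 ((mul_add M S S).trans h3)
    linarith
  have h4 : ∀ i, ‖q i‖ ^ 2 = r ^ 2 * (M - 1) / (2 * M) := by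
    intro i
    have := h1 i
    rw [hS2] at this
    field_simp
    linarith
  have h5 := norm_sub_sq_real (q i) (q j)
  rw [hsq, h4, h4] at h5
  have h6 : inner ℝ (q i) (q j) =
      r ^ 2 * (M - 1) / (2 * M) - r ^ 2 * (1 - if i = j then 1 else 0) / 2 := by linarith
  rw [h6]
  field_simp
  ring

theorem Affine.Simplex.Equilateral.exists_closedInterior_eq {D : ℕ} (hD : 1 ≤ D)
    {s : Affine.Simplex ℝ (EuclideanSpace ℝ (Fin D)) D} (hs : s.Equilateral) :
    ∃ (c : EuclideanSpace ℝ (Fin D)) (q : Fin (D + 1) → EuclideanSpace ℝ (Fin D)) (r h : ℝ),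
      0 < r ∧ 0 < h ∧ (∀ i, ‖q i‖ = r) ∧
      s.closedInterior = {x | ∀ i, -h ≤ inner ℝ (q i) (x - c)} := by
  obtain ⟨l, hl⟩ := hs
  set M : ℝ := (Fintype.card (Fin (D + 1)) : ℝ) with hM
  have hMD : M = D + 1 := by simp [hM]
  have hD0 : (1 : ℝ) ≤ D := by exact_mod_cast hD
  have hMpos : 0 < M := by linarith
  have hl0 : 0 < l := by
    have h01 : (0 : Fin (D + 1)) ≠ Fin.last D := by
      intro h
      have := congrArg Fin.val h
      simp at this
      omega
    rw [← hl _ _ h01]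
    exact dist_pos.2 (s.independent.injective.ne h01)
  set c : EuclideanSpace ℝ (Fin D) := M⁻¹ • ∑ i, s.points i with hc
  set q : Fin (D + 1) → EuclideanSpace ℝ (Fin D) := fun i => s.points i - c with hq
  have hqsum : ∑ i, q i = 0 := by
    rw [hq, Finset.sum_sub_distrib, Finset.sum_const, Finset.card_univ, ← Nat.cast_smul_eq_nsmul ℝ,
      ← hM, hc, smul_smul, mul_inv_cancel₀ hMpos.ne', one_smul, sub_self]
  have hinner := inner_eq_of_sum_eq_zero_of_norm_sub hqsum (r := l) fun i j hij => by
    rw [hq, sub_sub_sub_cancel_right, ← dist_eq_norm, hl i j hij]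
  rw [← hM] at hinner
  let b : AffineBasis (Fin (D + 1)) ℝ (EuclideanSpace ℝ (Fin D)) :=
    ⟨s.points, s.independent, by
      rw [s.independent.affineSpan_eq_top_iff_card_eq_finrank_add_one]; simp⟩
  -- Pairing with q i is an increasing affine function of the i-th barycentric coordinate, so
  -- nonnegativity of that coordinate becomes the lower bound -h.
  have hcoord : ∀ i x, inner ℝ (q i) (x - c) = l ^ 2 / 2 * (b.coord i x - 1 / M) := by
    intro i x
    have hx : x - c = ∑ j, b.coord j x • q j := by
      simp only [hq, smul_sub, Finset.sum_sub_distrib]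
      rw [← Finset.sum_smul, b.sum_coord_apply_eq_one, one_smul]
      congr 1
      exact (b.linear_combination_coord_eq_self x).symm
    rw [hx, inner_sum]
    simp only [inner_smul_right, hinner]
    have : ∀ j, b.coord j x * (l ^ 2 / 2 * ((if i = j then 1 else 0) - 1 / M)) =
        l ^ 2 / 2 * (if i = j then b.coord j x else 0) - l ^ 2 / 2 * (1 / M) * b.coord j x := by
      intro j
      split_ifs <;> ring
    simp only [this]
    rw [Finset.sum_sub_distrib, ← Finset.mul_sum, ← Finset.mul_sum, b.sum_coord_apply_eq_one]
    simp
    ring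
  refine ⟨c, q, √(l ^ 2 / 2 * (1 - 1 / M)), l ^ 2 / 2 * (1 / M), ?_, by positivity, fun i => ?_, ?_⟩
  · have : 1 / M < 1 := by rw [div_lt_one hMpos]; linarith
    have : 0 < 1 - 1 / M := by linarith
    positivity
  · have := hinner i i
    rw [real_inner_self_eq_norm_sq, if_pos rfl] at this
    rw [← this, Real.sqrt_sq (norm_nonneg _)]
  · rw [← Affine.Simplex.convexHull_eq_closedInterior]
    have h1 := b.convexHull_eq_nonneg_coord
    have h2 : range s.points = range b := rfl
    rw [h2, h1]
    ext x
    simp only [mem_ofPred_eq, hcoord]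
    refine forall_congr' fun i => ?_
    have hl2 : 0 < l ^ 2 / 2 := by positivity
    rw [← mul_neg, mul_le_mul_iff_right₀ hl2]
    constructor <;> intro h <;> linarith

/-- At a boundary point some constraint is active. If a normal exists there, the local half-space
lies in that constraint, which forces n = -q i / r and the radius h / r. -/
theorem isStarRegularPolytope_of_eq {D m : ℕ} {K : Set (EuclideanSpace ℝ (Fin D))}
    (hK : IsCompact K) {c : EuclideanSpace ℝ (Fin D)} {q : Fin m → EuclideanSpace ℝ (Fin D)}
    {r h : ℝ} (hr : 0 < r) (hh : 0 < h) (hq : ∀ i, ‖q i‖ = r)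
    (heq : K = {x | ∀ i, -h ≤ inner ℝ (q i) (x - c)}) : IsStarRegularPolytope K := by
  classical
  have hconv : Convex ℝ K := by
    have : K = ⋂ i, {x | -h + inner ℝ (q i) c ≤ inner ℝ (q i) x} := by
      rw [heq]; ext x; simp [inner_sub_right, le_sub_iff_add_le]
    rw [this]
    exact convex_iInter fun i => convex_halfSpace_ge
      ⟨fun _ _ => inner_add_right _ _ _, fun _ _ => by rw [inner_smul_right]; rfl⟩ _
  have hint : ∀ x, (∀ i, -h < inner ℝ (q i) (x - c)) → x ∈ interior K := by
    intro x hx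
    rw [mem_interior_iff_mem_nhds, heq]
    change ∀ᶠ y in 𝓝 x, ∀ i, -h ≤ inner ℝ (q i) (y - c)
    rw [Filter.eventually_all]
    intro i
    have hc : ContinuousAt (fun y => inner ℝ (q i) (y - c)) x := Continuous.continuousAt (by fun_prop)
    filter_upwards [continuousAt_const.eventually_lt hc (hx i)] with y hy using hy.le
  have hcint : c ∈ interior K := hint c fun i => by simpa using hh
  refine ⟨⟨⟨c, interior_subset hcint⟩, hK, ?_, {K}, finite_singleton K, ?_, by simp⟩, c,
    hconv.starConvex (interior_subset hcint), h / r, div_pos hh hr, fun x n hn => ?_⟩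
  · rw [hconv.closure_interior_eq_closure_of_nonempty_interior ⟨c, hcint⟩, hK.isClosed.closure_eq]
  · rintro _ rfl
    refine ⟨Finset.univ.image fun i => (-q i, h - inner ℝ (q i) c), ?_⟩
    rw [heq]
    ext x
    simp only [mem_ofPred_eq, Finset.mem_image, Finset.mem_univ, true_and, forall_exists_index,
      forall_apply_eq_imp_iff, inner_neg_left, inner_sub_right]
    refine forall_congr' fun i => ?_
    constructor <;> intro h <;> linarith
  · obtain ⟨i, hi⟩ : ∃ i, inner ℝ (q i) (x - c) ≤ -h := by
      by_contra! hcon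
      exact hn.1.2 (hint x hcon)
    have hxK : x ∈ K := hK.isClosed.frontier_subset hn.1
    have hxi : inner ℝ (q i) (x - c) = -h := le_antisymm hi (by rw [heq] at hxK; exact hxK i)
    have hnq : n = -(r⁻¹ • q i) := by
      refine eq_of_eventually_inner_nonpos_imp (x := x) hn.2.1 ?_ ?_
      · rw [norm_neg, norm_smul, hq, norm_inv, Real.norm_of_nonneg hr.le, inv_mul_cancel₀ hr.ne']
      · filter_upwards [(isOutwardUnitNormal_iff.1 hn).2] with y hy hle
        have hyK := hy.2 hle
        rw [heq] at hyK
        have h1 := hyK i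
        have h2 : inner ℝ (q i) (y - x) = inner ℝ (q i) (y - c) + h := by
          rw [← sub_sub_sub_cancel_right y x c, inner_sub_right, hxi, sub_neg_eq_add]
        rw [inner_neg_left, real_inner_smul_left, h2, neg_nonpos]
        exact mul_nonneg (inv_nonneg.2 hr.le) (by linarith)
    rw [hnq, inner_neg_left, real_inner_smul_left, hxi]
    field_simp

theorem Affine.Simplex.Equilateral.isStarRegularPolytope_closedInterior {D : ℕ} (hD : 1 ≤ D)
    {s : Affine.Simplex ℝ (EuclideanSpace ℝ (Fin D)) D} (hs : s.Equilateral) :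
    IsStarRegularPolytope s.closedInterior := by
  obtain ⟨c, q, r, h, hr, hh, hq, heq⟩ := hs.exists_closedInterior_eq hD
  exact isStarRegularPolytope_of_eq s.isCompact_closedInterior hr hh hq heq

end

theorem mainTheorem12 (D k : ℕ) (hD : 1 ≤ D) :
    (∀ K : Set (EuclideanSpace ℝ (Fin D)), IsStarRegularPolytope K →
      IsLUB (boundaryCrowding K '' positiveSolutions K k) (optimalInteriorWeight K k) ∧
        optimalInteriorWeight K k ≤ starWeight D k) ∧
    (∀ s : Affine.Simplex ℝ (EuclideanSpace ℝ (Fin D)) D, s.Equilateral →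
      IsStarRegularPolytope s.closedInterior ∧
        IsLUB (boundaryCrowding s.closedInterior '' positiveSolutions s.closedInterior k)
          (optimalInteriorWeight s.closedInterior k) ∧
        optimalInteriorWeight s.closedInterior k ≤ starWeight D k) :=
  ⟨fun _ hK => optimalInteriorWeight_le_of_isStarRegularPolytope hD k hK, fun _ hs =>
    have hK := hs.isStarRegularPolytope_closedInterior hD
    ⟨hK, optimalInteriorWeight_le_of_isStarRegularPolytope hD k hK⟩⟩
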